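/- Setting. Let $p\in\mathbb N$, $q\in\{1,2\}$, $M>0$, and let $\mu$ be a finite nonzero measure on $\mathbb R$ whose support is contained in some interval $[a,b]$ with $0<a\le b<\infty$. Put $h(z)=\int e^{-tz}\,\mu(dt)$. For a probability measure $Q$ on $\mathbb R^p\times\mathbb R$ let $$F^{\rm ML}(\beta;Q)=-\mathbb E\Big[YY'\,h\Big(\sum_{i=1}^p\beta_i|X_i-X_i'|^q\Big)\Big],$$ where $(X,Y),(X',Y')$ are independent with law $Q$. Let $\mathcal B=\{\beta\in\mathbb R^p:0\le\beta_i\le M \text{ for all } i\}$. For a starting point $\beta_0\in\mathcal B$, a gradient flow of $F^{\rm ML}(\cdot;Q_n)$ is a function $\widetilde\beta:[0,\infty)\to\mathbb R^p$ of the form $\widetilde\beta(t)=\beta_0+\int_0^t v(s)\,ds$ with $v$ locally integrable and $v(s)\in-\nabla F^{\rm ML}(\widetilde\beta(s);Q_n)-\mathcal N_{\mathcal B}(\widetilde\beta(s))$ for almost every $s\ge 0$, where $\mathcal N_{\mathcal B}$ is the normal cone of $\mathcal B$ (empty outside $\mathcal B$) and $Q_n$ is the empirical distribution of $n$ i.i.d.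 observations from $Q$. The maximal correlation of $W_1,W_2$ is $$\vartheta(W_1,W_2)=\sup_{g_1,g_2}\frac{\mathrm{Cov}(g_1(W_1),g_2(W_2))}{\sqrt{\mathrm{Var}(g_1(W_1))\,\mathrm{Var}(g_2(W_2))}},$$ the supremum being over measurable real functions for which both variances are finite and positive ($\vartheta=0$ if there are none). For $\beta\in\mathbb R^p$ write $\mathrm{supp}(\beta)=\{i:\beta_i\ne0\}$. Theorem. For all $M_X,M_Y\in\mathbb R$ and $v>0$ there is a constant $\kappa>0$, depending only on $p,q,M,\mu,M_X,M_Y,v$, such that the following holds. Let $Q$ be a probability measure on $\mathbb R^p\times\mathbb R$ with $\mathbb E_Q[Y]=0$, $\|X\|_\infty\le M_X$ and $|Y|\le M_Y$ almost surely, and $\mathrm{Var}_Q(X_l)\ge v$ for all $l$. Let $S\subseteq\{1,\dots,p\}$ satisfy $\mathbb E_Q[Y|X]=\mathbb E_Q[Y|X_S]$ a.s., and suppose that the empty set does not have this property (that is, $\mathbb E_Q[Y|X]$ is not a.s. constant; in particular $S\neq\emptyset$). Let $\beta_0\in\mathcal B$ have full support, $\mathrm{supp}(\beta_0)=\{1,\dots,p\}$,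 and put $\vartheta_0=\kappa\,|F^{\rm ML}(\beta_0;Q)|$. Then $\vartheta_0>0$, and if $$\vartheta(X_S,X_{S^c})\le\vartheta_0,$$ then there are constants $c,\tau>0$ and $n_0\in\mathbb N$, independent of the sample size $n$, such that for every $n\ge n_0$, with probability at least $1-e^{-cn}$, every gradient flow $\widetilde\beta$ of $F^{\rm ML}(\cdot;Q_n)$ with $\widetilde\beta(0)=\beta_0$ satisfies $$\emptyset\ne\mathrm{supp}(\widetilde\beta(t))\subseteq S\qquad\text{for all } t\ge\tau.$$ -/

import Mathlib

open MeasureTheory ProbabilityTheory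
open scoped ENNReal

noncomputable section

namespace MetricLearning

/-- The data space: a feature vector `x` with `p` real coordinates and a real response `y`. -/
abbrev Obs (p : ℕ) : Type := (Fin p → ℝ) × ℝ

/-- The finite, nonzero measure `μ` lives on a set that is bounded and bounded away from zero. -/
structure KernelMeasure (μ : Measure ℝ) : Prop where
  finite : IsFiniteMeasure μ
  ne_zero : μ ≠ 0
  support_subset : ∃ a b : ℝ, 0 < a ∧ μ.support ⊆ Set.Icc a b

/-- The function `h z = ∫ exp (-t z) μ(dt)`. -/
def kernelFun (μ : Measure ℝ) (z : ℝ) : ℝ := ∫ t, Real.exp (-(t * z)) ∂μ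

/-- The weighted norm to the power `q`, that is `∑ i, β i * |z i| ^ q`. -/
def weightedNormPow {p : ℕ} (q : ℕ) (β : EuclideanSpace ℝ (Fin p)) (z : Fin p → ℝ) : ℝ :=
  ∑ i, β i * |z i| ^ q

/-- The metric learning objective `- E [Y Y' h (‖X - X'‖_{q, β} ^ q)]`, where `(X, Y)` and
`(X', Y')` are independent with law `Q`. -/
def objective {p : ℕ} (q : ℕ) (μ : Measure ℝ) (Q : Measure (Obs p))
    (β : EuclideanSpace ℝ (Fin p)) : ℝ :=
  -∫ w : Obs p × Obs p,
    w.1.2 * w.2.2 * kernelFun μ (weightedNormPow q β (fun i => w.1.1 i - w.2.1 i)) ∂(Q.prod Q)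

/-- The empirical distribution of a sample `z 0, …, z (n - 1)`. -/
def empiricalMeasure {p n : ℕ} (z : Fin n → Obs p) : Measure (Obs p) :=
  (n : ℝ≥0∞)⁻¹ • ∑ i, Measure.dirac (z i)

/-- The feasible box `{β : 0 ≤ β i ≤ M}`. -/
def feasibleSet (p : ℕ) (M : ℝ) : Set (EuclideanSpace ℝ (Fin p)) :=
  {β | ∀ i, 0 ≤ β i ∧ β i ≤ M}

/-- The normal cone of `B` at `x`; it is empty when `x ∉ B`. -/
def normalCone {p : ℕ} (B : Set (EuclideanSpace ℝ (Fin p))) (x : EuclideanSpace ℝ (Fin p)) :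
    Set (EuclideanSpace ℝ (Fin p)) :=
  {v | x ∈ B ∧ ∀ z ∈ B, inner ℝ v (z - x) ≤ 0}

/-- `β` solves, on `[0, ∞)`, the projected gradient inclusion
`dβ/dt ∈ - ∇ F (β) - N_B (β)`, `β 0 = β₀`: it is the integral of a locally integrable function
`v` which belongs to the right-hand side at almost every time. -/
def IsGradientFlow {p : ℕ} (F : EuclideanSpace ℝ (Fin p) → ℝ)
    (B : Set (EuclideanSpace ℝ (Fin p))) (β₀ : EuclideanSpace ℝ (Fin p))
    (β : ℝ → EuclideanSpace ℝ (Fin p)) : Prop :=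
  ∃ v : ℝ → EuclideanSpace ℝ (Fin p),
    (∀ t, 0 ≤ t → IntervalIntegrable v volume 0 t) ∧
    (∀ t, 0 ≤ t → β t = β₀ + ∫ s in (0 : ℝ)..t, v s) ∧
    ∀ᵐ s ∂(volume.restrict (Set.Ici (0 : ℝ))),
      ∃ g ∈ normalCone B (β s), v s = -gradient F (β s) - g

/-- The set of indices of the nonzero coordinates. -/
def coordSupport {p : ℕ} (β : EuclideanSpace ℝ (Fin p)) : Set (Fin p) := {i | β i ≠ 0}

/-- The subvector `X_S`. -/
def subFeatures {p : ℕ} (S : Finset (Fin p)) (z : Obs p) : S → ℝ := fun i => z.1 i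

/-- `E [Y | X] = E [Y | X_S]` almost surely: `X_S` has full predictive power for `Y`. -/
def FullPredictivePower {p : ℕ} (Q : Measure (Obs p)) (S : Finset (Fin p)) : Prop :=
  Q[fun z : Obs p => z.2 | MeasurableSpace.comap (fun z : Obs p => z.1) inferInstance]
    =ᵐ[Q] Q[fun z : Obs p => z.2 | MeasurableSpace.comap (subFeatures S) inferInstance]

/-- The maximal correlation of `W₁` and `W₂`: the supremum of the correlations of `g₁ (W₁)` and
`g₂ (W₂)` over measurable `g₁`, `g₂` for which the two variances are finite and positive.
It is `0` if there are no such functions, that is, if `W₁` or `W₂` is almost surely constant. -/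
def maximalCorrelation {Ω α₁ α₂ : Type*} [MeasurableSpace Ω] [MeasurableSpace α₁]
    [MeasurableSpace α₂] (P : Measure Ω) (W₁ : Ω → α₁) (W₂ : Ω → α₂) : ℝ :=
  sSup {r : ℝ | ∃ (g₁ : α₁ → ℝ) (g₂ : α₂ → ℝ), Measurable g₁ ∧ Measurable g₂ ∧
    MemLp (fun ω => g₁ (W₁ ω)) 2 P ∧ MemLp (fun ω => g₂ (W₂ ω)) 2 P ∧
    0 < variance (fun ω => g₁ (W₁ ω)) P ∧ 0 < variance (fun ω => g₂ (W₂ ω)) P ∧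
    r = covariance (fun ω => g₁ (W₁ ω)) (fun ω => g₂ (W₂ ω)) P /
      Real.sqrt (variance (fun ω => g₁ (W₁ ω)) P * variance (fun ω => g₂ (W₂ ω)) P)}

/-- Regularity of the population distribution: `Q` is a probability measure, `Y` is centered,
`X` and `Y` are bounded by `MX` and `MY`, and every coordinate of `X` has variance at
least `v`. -/
structure RegularPopulation {p : ℕ} (Q : Measure (Obs p)) (MX MY v : ℝ) : Prop where
  prob : IsProbabilityMeasure Q
  centered : ∫ z, z.2 ∂Q = 0
  bounded_features : ∀ᵐ z ∂Q, ∀ i, |z.1 i| ≤ MX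
  bounded_response : ∀ᵐ z ∂Q, |z.2| ≤ MY
  variance_ge : ∀ i, v ≤ variance (fun z : Obs p => z.1 i) Q

end MetricLearning

end

noncomputable section

namespace MetricLearning

open Set Filter Topology

variable {p : ℕ}

/-! Write `h` as a mixture of exponentials. At a scale `t`, the kernel `exp (-t ∑ β i |x i - x' i| ^
q)` is a product of a factor in the features of `S` and a factor in those outside. Replace `Y` by a
bounded function of `X_S`. A small maximal correlation then nearly decouples the two factors, so
value and slope at scale `t` are close to `A * E V` and `A * E W`. Here `A` is the quadratic form of
the `S`-kernel, `V` is the kernel factor outside `S`, and `W` is `V` weighted by `|X_l - X_l'| ^ q`.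
Since `A ≥ 0` (positive semidefiniteness), `E V ≤ 1`, and `E W` is bounded below through the
variance, the slope towards any `l ∉ S` is at least a constant times `-F`, up to an error
proportional to the maximal correlation (`scaleSlope_ge`, `objectiveSlope_ge`).

The flow never increases the objective (`IsGradientFlow.objective_le`), so `-F` stays of order `|F
β₀|`. Each coordinate outside `S` therefore decreases at a fixed rate while positive, and is zero
from a fixed time on (`IsGradientFlow.coord_eq_zero`). The support cannot become empty, because `F 0
= 0` for centered `Y` while the flow stays near or below `F β₀ < 0`. That strict sign is strict
positive definiteness: the exponential kernels have convolution roots with nonvanishing Fourier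
transform (`exists_convolutionRoot`), so a zero value would force `E[Y | X] = 0`.

The sample enters only through uniform concentration of the objective and its slopes over the box
(`exists_objective_concentration`); the margins above absorb the resulting `ε`
(`IsGradientFlow.support_recovery`). -/

lemma isCompact_feasibleSet (p : ℕ) (M : ℝ) : IsCompact (feasibleSet p M) := by
  have h : feasibleSet p M = (EuclideanSpace.equiv (Fin p) ℝ).toHomeomorph ⁻¹'
      (Set.univ.pi fun _ => Icc 0 M) := by
    ext β
    simp only [feasibleSet, mem_ofPred_eq, mem_preimage, mem_univ_pi, mem_Icc]
    rfl
  rw [h, Homeomorph.isCompact_preimage]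
  exact isCompact_univ_pi fun _ => isCompact_Icc

lemma convex_feasibleSet (p : ℕ) (M : ℝ) : Convex ℝ (feasibleSet p M) := by
  intro x hx y hy a b ha hb hab i
  have h1 := hx i
  have h2 := hy i
  simp only [PiLp.add_apply, PiLp.smul_apply, smul_eq_mul]
  constructor
  · have := mul_nonneg ha h1.1
    have := mul_nonneg hb h2.1
    linarith
  · have e1 := mul_le_mul_of_nonneg_left h1.2 ha
    have e2 := mul_le_mul_of_nonneg_left h2.2 hb
    have : a * M + b * M = M := by rw [← add_mul, hab, one_mul]
    linarith

/-- A primitive of a locally integrable function on `[0, ∞)` has it as derivative almost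
everywhere. -/
lemma ae_hasDerivAt_primitive {E : Type*} [NormedAddCommGroup E] [NormedSpace ℝ E]
    [CompleteSpace E] {v : ℝ → E}
    (hv : ∀ t, 0 ≤ t → IntervalIntegrable v volume 0 t) (x₀ : E) :
    ∀ᵐ t, 0 ≤ t → HasDerivAt (fun t => x₀ + ∫ s in (0 : ℝ)..t, v s) (v t) t := by
  have h : ∀ n : ℕ, ∀ᵐ t, t ∈ uIcc (0 : ℝ) n → ∀ c ∈ uIcc (0 : ℝ) n,
      HasDerivAt (fun x => ∫ s in c..x, v s) (v t) t :=
    fun n => (hv n n.cast_nonneg).ae_hasDerivAt_integral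
  filter_upwards [ae_all_iff.2 h] with t ht h0
  obtain ⟨n, hn⟩ := exists_nat_ge t
  have := ht n (by rw [uIcc_of_le n.cast_nonneg]; exact ⟨h0, hn⟩) 0 (by simp)
  exact this.const_add x₀

lemma continuousOn_primitive_Ici {E : Type*} [NormedAddCommGroup E] [NormedSpace ℝ E] {v : ℝ → E}
    (hv : ∀ t, 0 ≤ t → IntervalIntegrable v volume 0 t) (x₀ : E) :
    ContinuousOn (fun t => x₀ + ∫ s in (0 : ℝ)..t, v s) (Ici 0) := by
  intro t ht
  have ht' : (0 : ℝ) ≤ t := ht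
  have h := intervalIntegral.continuousOn_primitive_interval' (hv (t + 1) (by linarith))
    (a := 0) (by simp)
  rw [uIcc_of_le (by linarith)] at h
  refine ((h t ⟨ht', by linarith⟩).mono_of_mem_nhdsWithin ?_).const_add x₀ |>.congr
    (fun _ _ => rfl) rfl
  rw [← Ici_inter_Iic]
  exact inter_mem_nhdsWithin _ (Iic_mem_nhds (by linarith))

/-! ### Projected gradient flows: invariance, descent, extinction of coordinates. -/

section Flow

variable {F : EuclideanSpace ℝ (Fin p) → ℝ} {B : Set (EuclideanSpace ℝ (Fin p))}
  {β₀ : EuclideanSpace ℝ (Fin p)} {β : ℝ → EuclideanSpace ℝ (Fin p)}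

lemma IsGradientFlow.zero (h : IsGradientFlow F B β₀ β) : β 0 = β₀ := by
  obtain ⟨v, -, hβ, -⟩ := h
  simpa using hβ 0 le_rfl

lemma IsGradientFlow.continuousOn (h : IsGradientFlow F B β₀ β) : ContinuousOn β (Ici 0) := by
  obtain ⟨v, hv, hβ, -⟩ := h
  exact (continuousOn_primitive_Ici hv β₀).congr fun t ht => hβ t ht

/-- The normal cone is empty off `B`, so the inclusion already forces membership at almost every
time. An exit from the closed set would by continuity last for an interval of positive length. -/
lemma IsGradientFlow.mem (h : IsGradientFlow F B β₀ β) (hB : IsClosed B) {t : ℝ} (ht : 0 ≤ t) :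
    β t ∈ B := by
  by_contra hmem
  have hc := h.continuousOn t ht
  have hev : ∀ᶠ s in 𝓝[≥] t, β s ∉ B :=
    (hc.mono (Ici_subset_Ici.2 ht)).eventually (hB.isOpen_compl.mem_nhds hmem)
  obtain ⟨u, hu, hsub⟩ := (mem_nhdsGE_iff_exists_Ico_subset).1 hev
  obtain ⟨v, -, -, hae⟩ := h
  rw [ae_restrict_iff' measurableSet_Ici] at hae
  have hnull : volume (Ioo t u) = 0 := by
    refine measure_mono_null (fun s hs => ?_) (ae_iff.1 hae)
    intro hcon
    obtain ⟨g, hg, -⟩ := hcon (ht.trans hs.1.le)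
    exact hsub ⟨hs.1.le, hs.2⟩ hg.1
  rw [Real.volume_Ioo, ENNReal.ofReal_eq_zero] at hnull
  have : t < u := hu
  linarith

/-- Along a projected gradient flow the velocity is orthogonal to the normal vector. -/
lemma IsGradientFlow.exists_velocity (h : IsGradientFlow F B β₀ β) (hB : IsClosed B) :
    ∃ v : ℝ → EuclideanSpace ℝ (Fin p),
      (∀ t, 0 ≤ t → IntervalIntegrable v volume 0 t) ∧
      (∀ t, 0 ≤ t → β t = β₀ + ∫ s in (0 : ℝ)..t, v s) ∧
      ∀ᵐ t, 0 < t → HasDerivAt β (v t) t ∧ ∃ g ∈ normalCone B (β t),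
        v t = -gradient F (β t) - g ∧ inner ℝ g (v t) = 0 := by
  have hmem := fun t (ht : 0 ≤ t) => h.mem hB ht
  obtain ⟨v, hv, hβ, hae⟩ := h
  refine ⟨v, hv, hβ, ?_⟩
  rw [ae_restrict_iff' measurableSet_Ici] at hae
  filter_upwards [hae, ae_hasDerivAt_primitive hv β₀] with t h1 h2 ht
  obtain ⟨g, hg, hvg⟩ := h1 ht.le
  have hd : HasDerivAt β (v t) t := by
    refine (h2 ht.le).congr_of_eventuallyEq ?_
    filter_upwards [Ioi_mem_nhds ht] with s hs using hβ s (le_of_lt hs)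
  refine ⟨hd, g, hg, hvg, ?_⟩
  -- The normal cone inequality makes this function at most its value `0` at `s = t`. As `t > 0`,
  -- this is a two-sided local maximum, so the derivative vanishes.
  have hd' : HasDerivAt (fun s => inner ℝ g (β s - β t)) (inner ℝ g (v t)) t := by
    simpa using (hasDerivAt_const t g).inner ℝ (hd.sub_const (β t))
  refine IsLocalMax.hasDerivAt_eq_zero ?_ hd'
  filter_upwards [Ioi_mem_nhds ht] with s hs
  simpa using hg.2 _ (hmem s (le_of_lt hs))

lemma ContDiff.continuous_gradient (hF : ContDiff ℝ 1 F) : Continuous (gradient F) :=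
  (InnerProductSpace.toDual ℝ _).symm.continuous.comp (hF.continuous_fderiv (by norm_num))

/-- The objective does not increase along a projected gradient flow. -/
lemma IsGradientFlow.objective_le (h : IsGradientFlow F B β₀ β) (hB : IsCompact B)
    (hBc : Convex ℝ B) (hF : ContDiff ℝ 1 F) {t : ℝ} (ht : 0 ≤ t) : F (β t) ≤ F β₀ := by
  have hmem := fun t (ht : 0 ≤ t) => h.mem hB.isClosed ht
  have h0 := h.zero
  obtain ⟨v, hv, hβ, hae⟩ := h.exists_velocity hB.isClosed
  obtain ⟨C, hC⟩ := hB.exists_bound_of_continuousOn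
    (ContDiff.continuous_gradient hF).continuousOn
  have hinner : ∀ᵐ s, 0 < s → inner ℝ (gradient F (β s)) (v s) = -‖v s‖ ^ 2 := by
    filter_upwards [hae] with s hs hs0
    obtain ⟨-, g, -, hvg, hg0⟩ := hs hs0
    have : gradient F (β s) = -v s - g := by rw [hvg]; abel
    rw [this, inner_sub_left, inner_neg_left, hg0, real_inner_self_eq_norm_sq, sub_zero]
  -- Cauchy–Schwarz turns the identity for `⟨∇F, v⟩` into a velocity bound. It makes `β` Lipschitz,
  -- hence `F ∘ β` absolutely continuous, so the fundamental theorem of calculus applies to it.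
  have hbound : ∀ᵐ s, 0 < s → ‖v s‖ ≤ C := by
    filter_upwards [hinner] with s hs hs0
    have h1 := hs hs0
    have h2 := abs_real_inner_le_norm (gradient F (β s)) (v s)
    rw [h1, abs_neg, abs_of_nonneg (by positivity)] at h2
    have h3 := hC _ (hmem s hs0.le)
    by_contra hcon
    push Not at hcon
    have h4 : 0 < ‖v s‖ := lt_of_le_of_lt ((norm_nonneg _).trans h3) hcon
    nlinarith
  obtain ⟨K, hK⟩ := hF.contDiffOn.exists_lipschitzOnWith (by norm_num) hBc hB
  have hC0 : 0 ≤ C := (norm_nonneg _).trans (hC _ (hmem 0 le_rfl))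
  have hlip : LipschitzOnWith C.toNNReal β (Icc 0 t) := by
    refine LipschitzOnWith.of_dist_le_mul fun x hx y hy => ?_
    rw [dist_eq_norm, hβ x hx.1, hβ y hy.1, add_sub_add_left_eq_sub,
      intervalIntegral.integral_interval_sub_left (hv x hx.1) (hv y hy.1),
      Real.coe_toNNReal _ hC0, Real.dist_eq]
    refine intervalIntegral.norm_integral_le_of_norm_le_const_ae ?_
    filter_upwards [hbound] with s hs hs'
    exact hs (lt_of_le_of_lt (le_min hy.1 hx.1) hs'.1)
  have hlip2 : LipschitzOnWith (K * C.toNNReal) (F ∘ β) (uIcc 0 t) := by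
    rw [uIcc_of_le ht]
    exact hK.comp hlip fun x hx => hmem x hx.1
  have hFTC := hlip2.absolutelyContinuousOnInterval.integral_deriv_eq_sub
  have hneg : ∫ x in (0 : ℝ)..t, deriv (F ∘ β) x ≤ 0 := by
    rw [intervalIntegral.integral_of_le ht]
    refine integral_nonpos_of_ae ?_
    rw [EventuallyLE, ae_restrict_iff' measurableSet_Ioc]
    filter_upwards [hae, hinner] with s hs hs' hs0
    have hd := (hs hs0.1).1
    have hg : HasFDerivAt F (InnerProductSpace.toDual ℝ _ (gradient F (β s))) (β s) :=
      ((hF.differentiable (by norm_num)) (β s)).hasGradientAt.hasFDerivAt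
    rw [(hg.comp_hasDerivAt s hd).deriv]
    simp only [InnerProductSpace.toDual_apply_apply, hs' hs0.1, Pi.zero_apply]
    nlinarith [norm_nonneg (v s)]
  simp only [Function.comp_apply, h0] at hFTC
  linarith

/-- A coordinate which decreases at a uniform rate wherever it is positive vanishes after a
uniform time. -/
lemma eq_zero_of_decay {x w : ℝ → ℝ} {c M : ℝ} (hc : 0 < c)
    (hx : ContinuousOn x (Ici 0)) (hx0 : ∀ t, 0 ≤ t → 0 ≤ x t) (hxM : x 0 ≤ M)
    (hw : ∀ t, 0 ≤ t → IntervalIntegrable w volume 0 t)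
    (hxw : ∀ t, 0 ≤ t → x t = x 0 + ∫ s in (0 : ℝ)..t, w s)
    (hdec : ∀ᵐ t, 0 < t → 0 < x t → w t ≤ -c) {t : ℝ} (ht : 0 ≤ t) (htM : M / c < t) :
    x t = 0 := by
  by_contra hne
  have hpos : 0 < x t := lt_of_le_of_ne (hx0 t ht) (Ne.symm hne)
  have key : ∀ s, 0 ≤ s → s ≤ t → (∀ r, s < r → r ≤ t → 0 < x r) → x t ≤ x s - c * (t - s) := by
    intro s hs hst hr
    have e : x t = x s + ∫ r in s..t, w r := by
      rw [hxw t ht, hxw s hs, add_assoc,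
        intervalIntegral.integral_add_adjacent_intervals (hw s hs) ((hw s hs).symm.trans (hw t ht))]
    have hi : IntervalIntegrable w volume s t := (hw s hs).symm.trans (hw t ht)
    have : ∫ r in s..t, w r ≤ ∫ r in s..t, -c := by
      rw [intervalIntegral.integral_of_le hst, intervalIntegral.integral_of_le hst]
      refine setIntegral_mono_ae_restrict hi.1 (by simp) ?_
      rw [EventuallyLE, ae_restrict_iff' measurableSet_Ioc]
      filter_upwards [hdec] with r hr1 hr2
      exact hr1 (lt_of_le_of_lt hs hr2.1) (hr r hr2.1 hr2.2)
    rw [intervalIntegral.integral_const, smul_eq_mul] at this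
    rw [e]; linarith
  -- If `x` vanishes before `t`, start the decay at the last such time; otherwise start at `0`,
  -- where `x ≤ M`. Either way `x t > 0` is impossible.
  by_cases hZ : ∃ r ∈ Icc 0 t, x r ≤ 0
  · have hcomp : IsCompact {r ∈ Icc 0 t | x r ≤ 0} := by
      have := (hx.mono (Icc_subset_Ici_self : Icc 0 t ⊆ Ici 0)).preimage_isClosed_of_isClosed
        isClosed_Icc (isClosed_Iic (a := (0 : ℝ)))
      exact isCompact_Icc.of_isClosed_subset this inter_subset_left
    obtain ⟨s, ⟨hs, hs0⟩, hmax⟩ := hcomp.exists_isGreatest hZ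
    have h1 := key s hs.1 hs.2 fun r hr hrt => by
      by_contra hcon
      exact absurd (hmax ⟨⟨hs.1.trans hr.le, hrt⟩, not_lt.1 hcon⟩) (not_le.2 hr)
    have : 0 ≤ c * (t - s) := mul_nonneg hc.le (by linarith [hs.2])
    linarith
  · push Not at hZ
    have h1 := key 0 le_rfl ht fun r hr hrt => hZ r ⟨hr.le, hrt⟩
    rw [div_lt_iff₀ hc] at htM
    linarith

/-- By descent, the gradient bound is needed only on the sublevel set of `β₀`. The projection can
only help: where the coordinate is positive, the normal vector has a nonnegative entry there. -/
lemma IsGradientFlow.coord_eq_zero {M c : ℝ} (h : IsGradientFlow F (feasibleSet p M) β₀ β)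
    (hF : ContDiff ℝ 1 F) (l : Fin p) (hc : 0 < c)
    (hgrad : ∀ x ∈ feasibleSet p M, F x ≤ F β₀ → c ≤ gradient F x l)
    {t : ℝ} (ht : 0 ≤ t) (htM : M / c < t) : β t l = 0 := by
  have hB := isCompact_feasibleSet p M
  have hmem := fun t (ht : 0 ≤ t) => h.mem hB.isClosed ht
  have hdesc := fun t (ht : 0 ≤ t) => h.objective_le hB (convex_feasibleSet p M) hF ht
  have h0 := h.zero
  have hcont := h.continuousOn
  obtain ⟨v, hv, hβ, hae⟩ := h.exists_velocity hB.isClosed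
  let L : EuclideanSpace ℝ (Fin p) →L[ℝ] ℝ := EuclideanSpace.proj l
  have hL : ∀ x, L x = x l := fun x => rfl
  refine eq_zero_of_decay (x := fun t => β t l) (w := fun t => v t l) hc
    (L.continuous.comp_continuousOn hcont)
    (fun t ht => (hmem t ht l).1) (hmem 0 le_rfl l).2
    (fun t ht => ⟨L.integrable_comp (hv t ht).1, L.integrable_comp (hv t ht).2⟩) ?_ ?_ ht htM
  · intro t ht
    have := L.intervalIntegral_comp_comm (hv t ht)
    simp only [hL] at this
    rw [this, h0, hβ t ht]; rfl
  · filter_upwards [hae] with s hs hs0 hpos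
    obtain ⟨-, g, hg, hvg, -⟩ := hs hs0
    -- Testing the normal cone against the point with coordinate `l` set to zero gives `β s l * g l
    -- ≥ 0`.
    have hz : β s - EuclideanSpace.single l (β s l) ∈ feasibleSet p M := by
      intro i
      by_cases hi : i = l
      · subst hi; simpa using (hmem 0 le_rfl i).1.trans (hmem 0 le_rfl i).2
      · simpa [hi] using hmem s hs0.le i
    have h1 := hg.2 _ hz
    rw [sub_sub_cancel_left, inner_neg_right, EuclideanSpace.inner_single_right] at h1
    simp only [conj_trivial] at h1
    have h2 : 0 ≤ g l := by
      by_contra hcon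
      push Not at hcon
      nlinarith
    have h3 := hgrad _ (hmem s hs0.le) (hdesc s hs0.le)
    rw [hvg]
    simp only [PiLp.sub_apply, PiLp.neg_apply]
    linarith

end Flow

/-! ### Exponential concentration of sample means, uniformly in a compact parameter. -/

section Concentration

/-- Hoeffding's inequality for the mean of a bounded function of an i.i.d. sample. -/
lemma measureReal_mean_sub_integral_ge {Z : Type*} [MeasurableSpace Z] (Q : Measure Z)
    [IsProbabilityMeasure Q] {f : Z → ℝ} (hf : Measurable f) {b ε : ℝ}
    (hfb : ∀ᵐ z ∂Q, |f z| ≤ b) (hε : 0 ≤ ε) {n : ℕ} (hn : 0 < n) :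
    (Measure.pi fun _ : Fin n => Q).real {z | ε ≤ (n : ℝ)⁻¹ * ∑ j, f (z j) - ∫ z, f z ∂Q}
      ≤ Real.exp (-(n * ε ^ 2 / (2 * b ^ 2))) := by
  have hn' : (0 : ℝ) < n := by exact_mod_cast hn
  have hsub : HasSubgaussianMGF (fun z => f z - ∫ z, f z ∂Q) ((‖b - -b‖₊ / 2) ^ 2) Q :=
    hasSubgaussianMGF_of_mem_Icc hf.aemeasurable (by filter_upwards [hfb] with z hz using abs_le.1 hz)
  have hind : iIndepFun (fun (j : Fin n) (z : Fin n → Z) => f (z j) - ∫ z, f z ∂Q)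
      (Measure.pi fun _ : Fin n => Q) :=
    iIndepFun_pi (X := fun _ z => f z - ∫ z, f z ∂Q) fun _ => (hf.sub_const _).aemeasurable
  have h := HasSubgaussianMGF.measure_sum_ge_le_of_iIndepFun hind (s := Finset.univ)
    (c := fun _ => (‖b - -b‖₊ / 2) ^ 2) (ε := n * ε) (fun j _ => by
      have hm := measurePreserving_eval (fun _ : Fin n => Q) j
      refine HasSubgaussianMGF.of_map (X := fun z => f z - ∫ z, f z ∂Q)
        (Y := fun z : Fin n → Z => z j) hm.measurable.aemeasurable ?_
      rw [hm.map_eq]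
      exact hsub) (by positivity)
  refine le_trans (le_of_eq ?_) (h.trans (le_of_eq ?_))
  · congr 1
    ext z
    simp only [mem_ofPred_eq, Finset.sum_sub_distrib, Finset.sum_const, Finset.card_univ,
      Fintype.card_fin, nsmul_eq_mul]
    rw [← mul_le_mul_iff_right₀ hn', mul_sub, mul_inv_cancel_left₀ hn'.ne']
  · congr 1
    have e : ((‖b - -b‖₊ / 2 : NNReal) : ℝ) ^ 2 = b ^ 2 := by
      simp only [NNReal.coe_div, coe_nnnorm, Real.norm_eq_abs, NNReal.coe_ofNat, sub_neg_eq_add,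
        div_pow, sq_abs]
      ring
    simp only [Finset.sum_const, Finset.card_univ, Fintype.card_fin, nsmul_eq_mul, NNReal.coe_mul,
      NNReal.coe_natCast, NNReal.coe_pow, e]
    rw [neg_div, mul_pow, pow_two (n : ℝ), ← mul_assoc, mul_comm (2 : ℝ) n, mul_assoc, mul_assoc (n : ℝ) 2,
      mul_div_mul_left _ _ hn'.ne']

variable {Z : Type*} [MeasurableSpace Z] (Q : Measure Z) [IsProbabilityMeasure Q]

/-- Finitely many bounded functions have sample means close to their expectations, outside of an
event of exponentially small probability. -/
lemma exists_concentration_of_fintype {ι : Type*} [Fintype ι] {f : ι → Z → ℝ}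
    (hf : ∀ i, Measurable (f i)) {b : ℝ} (hb : 0 < b) {K : Set Z} (hK : MeasurableSet K)
    (hQK : ∀ᵐ z ∂Q, z ∈ K) (hfb : ∀ i, ∀ z ∈ K, |f i z| ≤ b) {ε : ℝ} (hε : 0 < ε) :
    ∃ c : ℝ, 0 < c ∧ ∃ n₀ : ℕ, 0 < n₀ ∧ ∀ n : ℕ, n₀ ≤ n → ∃ A : Set (Fin n → Z), MeasurableSet A ∧
      ENNReal.ofReal (1 - Real.exp (-(c * n))) ≤ Measure.pi (fun _ => Q) A ∧
      ∀ z ∈ A, (∀ j, z j ∈ K) ∧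
        ∀ i, |(n : ℝ)⁻¹ * ∑ j, f i (z j) - ∫ z, f i z ∂Q| ≤ ε := by
  have hfb' : ∀ i, ∀ᵐ z ∂Q, |f i z| ≤ b := fun i => hQK.mono (hfb i)
  -- This is half of the Hoeffding exponent. The other half absorbs the `2 * card ι` terms of the
  -- union bound once `c * n` exceeds that number, because `x * exp (-x) ≤ 1`.
  set c : ℝ := ε ^ 2 / (4 * b ^ 2) with hc
  have hc0 : 0 < c := by positivity
  refine ⟨c, hc0, ⌈2 * Fintype.card ι / c⌉₊ + 1, Nat.succ_pos _, fun n hn => ?_⟩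
  have hn0 : 0 < n := lt_of_lt_of_le (Nat.succ_pos _) hn
  have hcn : 2 * (Fintype.card ι : ℝ) ≤ c * n := by
    have h1 : 2 * (Fintype.card ι : ℝ) / c ≤ n :=
      (Nat.le_ceil _).trans (by exact_mod_cast (Nat.le_succ _).trans hn)
    rwa [div_le_iff₀ hc0, mul_comm (n : ℝ)] at h1
  set P := Measure.pi fun _ : Fin n => Q
  let U : ι → Set (Fin n → Z) := fun i => {z | ε ≤ (n : ℝ)⁻¹ * ∑ j, f i (z j) - ∫ z, f i z ∂Q}
  let V : ι → Set (Fin n → Z) := fun i =>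
    {z | ε ≤ (n : ℝ)⁻¹ * ∑ j, -f i (z j) - ∫ z, -f i z ∂Q}
  let W : Set (Fin n → Z) := (Set.univ.pi fun _ => K)ᶜ
  have hU : ∀ i, MeasurableSet (U i) := fun i => measurableSet_le (by fun_prop) (by fun_prop)
  have hV : ∀ i, MeasurableSet (V i) := fun i => measurableSet_le (by fun_prop) (by fun_prop)
  have hW : MeasurableSet W := (MeasurableSet.univ_pi fun _ => hK).compl
  have hW0 : P.real W = 0 := by
    have h : ∀ᵐ z ∂P, ∀ j, z j ∈ K := ae_all_iff.2 fun j =>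
      (measurePreserving_eval (fun _ : Fin n => Q) j).quasiMeasurePreserving.ae hQK
    have : P W = 0 := by
      refine measure_mono_null ?_ (ae_iff.1 h)
      intro z hz
      simpa [W, Set.mem_pi] using hz
    simp [Measure.real, this]
  have hUm : ∀ i, P.real (U i) ≤ Real.exp (-(2 * (c * n))) := fun i => by
    refine (measureReal_mean_sub_integral_ge Q (hf i) (hfb' i) hε.le hn0).trans (le_of_eq ?_)
    rw [hc]; congr 1; field_simp; ring
  have hVm : ∀ i, P.real (V i) ≤ Real.exp (-(2 * (c * n))) := fun i => by
    refine (measureReal_mean_sub_integral_ge Q (hf i).neg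
      (by simpa using hfb' i) hε.le hn0).trans (le_of_eq ?_)
    rw [hc]; congr 1; field_simp; ring
  refine ⟨(W ∪ ⋃ i, (U i ∪ V i))ᶜ,
    (hW.union (MeasurableSet.iUnion fun i => (hU i).union (hV i))).compl, ?_, ?_⟩
  · have hbad : P.real (W ∪ ⋃ i, (U i ∪ V i)) ≤ Real.exp (-(c * n)) := by
      calc P.real (W ∪ ⋃ i, (U i ∪ V i))
          ≤ P.real W + ∑ i, P.real (U i ∪ V i) :=
            (measureReal_union_le _ _).trans (by gcongr; exact measureReal_iUnion_fintype_le _)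
        _ ≤ 0 + ∑ _i : ι, 2 * Real.exp (-(2 * (c * n))) := by
            rw [hW0]
            gcongr with i
            refine (measureReal_union_le _ _).trans ?_
            linarith [hUm i, hVm i]
        _ = (2 * Fintype.card ι) * Real.exp (-(c * n)) * Real.exp (-(c * n)) := by
            rw [mul_assoc, ← Real.exp_add]
            simp only [Finset.sum_const, Finset.card_univ, nsmul_eq_mul]
            ring_nf
        _ ≤ (c * n) * Real.exp (-(c * n)) * Real.exp (-(c * n)) := by gcongr
        _ ≤ 1 * Real.exp (-(c * n)) := by
            gcongr
            rw [Real.exp_neg, ← div_eq_mul_inv, div_le_one (Real.exp_pos _)]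
            linarith [Real.add_one_le_exp (c * n)]
        _ = Real.exp (-(c * n)) := one_mul _
    rw [← ofReal_measureReal, probReal_compl_eq_one_sub
      (hW.union (MeasurableSet.iUnion fun i => (hU i).union (hV i)))]
    exact ENNReal.ofReal_le_ofReal (by linarith)
  · intro z hz
    simp only [compl_union, compl_iUnion, mem_inter_iff, mem_iInter, mem_compl_iff, W, U, V,
      not_not, Set.mem_pi, mem_univ, true_imp_iff, mem_ofPred_eq, not_le, Finset.sum_neg_distrib,
      integral_neg] at hz
    refine ⟨hz.1, fun i => abs_le.2 ⟨?_, (hz.2 i).1.le⟩⟩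
    linarith [(hz.2 i).2]

/-- Uniform concentration of the sample means of a compact, jointly continuous family of
functions. -/
lemma exists_uniform_concentration [PseudoMetricSpace Z] [BorelSpace Z] {T : Type*}
    [PseudoMetricSpace T] {K : Set Z} (hK : IsCompact K) (hKm : MeasurableSet K)
    (hQK : ∀ᵐ z ∂Q, z ∈ K) {Θ : Set T} (hΘ : IsCompact Θ) {ι : Type*} [Fintype ι]
    {g : ι → T → Z → ℝ} (hg : ∀ i, Continuous (Function.uncurry (g i))) {ε : ℝ} (hε : 0 < ε) :
    ∃ c : ℝ, 0 < c ∧ ∃ n₀ : ℕ, 0 < n₀ ∧ ∀ n : ℕ, n₀ ≤ n → ∃ A : Set (Fin n → Z), MeasurableSet A ∧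
      ENNReal.ofReal (1 - Real.exp (-(c * n))) ≤ Measure.pi (fun _ => Q) A ∧
      ∀ z ∈ A, (∀ j, z j ∈ K) ∧
        ∀ i, ∀ θ ∈ Θ, |(n : ℝ)⁻¹ * ∑ j, g i θ (z j) - ∫ z, g i θ z ∂Q| ≤ ε := by
  have hΘK := hΘ.prod hK
  have hbd : ∀ i, ∃ b, ∀ x ∈ Θ ×ˢ K, ‖Function.uncurry (g i) x‖ ≤ b := fun i =>
    hΘK.exists_bound_of_continuousOn (hg i).continuousOn
  choose b hb using hbd
  -- Uniform continuity on `Θ ×ˢ K` yields a finite net that works for all `z ∈ K` at once. Net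
  -- error, sample error and expectation error take `ε / 3` each.
  have hcov : ∀ i, ∃ t : Set T, t ⊆ Θ ∧ t.Finite ∧
      ∀ θ ∈ Θ, ∃ θ' ∈ t, ∀ z ∈ K, |g i θ z - g i θ' z| ≤ ε / 3 := fun i => by
    have hu := hΘK.uniformContinuousOn_of_continuous (hg i).continuousOn
    obtain ⟨δ, hδ, hδ'⟩ := Metric.uniformContinuousOn_iff.1 hu (ε / 3) (by positivity)
    obtain ⟨t, htΘ, htf, hcov⟩ := hΘ.finite_cover_balls hδ
    refine ⟨t, htΘ, htf, fun θ hθ => ?_⟩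
    obtain ⟨θ', hθ', hd⟩ := mem_iUnion₂.1 (hcov hθ)
    refine ⟨θ', hθ', fun z hz => ?_⟩
    have := hδ' (θ, z) ⟨hθ, hz⟩ (θ', z) ⟨htΘ hθ', hz⟩ (by
      simpa [Prod.dist_eq, hδ] using hd)
    exact this.le
  choose t htΘ htf hcov using hcov
  have := fun i => (htf i).fintype
  have hcont : ∀ i θ, Continuous (g i θ) := fun i θ => (hg i).comp (Continuous.prodMk_right θ)
  have hle : ∀ i, |b i| ≤ 1 + ∑ i, |b i| := fun i => by
    have := Finset.single_le_sum (f := fun i => |b i|) (fun i _ => abs_nonneg _) (Finset.mem_univ i)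
    linarith
  obtain ⟨c, hc, n₀, hn₀, H⟩ := exists_concentration_of_fintype Q
    (f := fun s : Σ i, t i => g s.1 s.2) (fun s => (hcont s.1 s.2).measurable)
    (b := 1 + ∑ i, |b i|) (by positivity) hKm hQK
    (fun s z hz => (hb s.1 (s.2, z) ⟨htΘ _ s.2.2, hz⟩).trans ((le_abs_self _).trans (hle _)))
    (ε := ε / 3) (by positivity)
  refine ⟨c, hc, n₀, hn₀, fun n hn => ?_⟩
  obtain ⟨A, hA, hAm, hAz⟩ := H n hn
  refine ⟨A, hA, hAm, fun z hz => ⟨(hAz z hz).1, fun i θ hθ => ?_⟩⟩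
  have hn' : (0 : ℝ) < n := by exact_mod_cast lt_of_lt_of_le hn₀ hn
  obtain ⟨θ', hθ', hclose⟩ := hcov i θ hθ
  have hint : ∀ ϑ ∈ Θ, Integrable (g i ϑ) Q := fun ϑ hϑ =>
    Integrable.of_bound (hcont i ϑ).aestronglyMeasurable (b i)
      (hQK.mono fun z hz => hb i (ϑ, z) ⟨hϑ, hz⟩)
  have h1 := (hAz z hz).2 ⟨i, θ', hθ'⟩
  simp only at h1
  have h2 : |∫ z, g i θ z ∂Q - ∫ z, g i θ' z ∂Q| ≤ ε / 3 := by
    rw [← integral_sub (hint θ hθ) (hint θ' (htΘ i hθ'))]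
    have := norm_integral_le_of_norm_le_const (f := fun z => g i θ z - g i θ' z)
      (hQK.mono hclose)
    simpa using this
  have h3 : |(n : ℝ)⁻¹ * ∑ j, g i θ (z j) - (n : ℝ)⁻¹ * ∑ j, g i θ' (z j)| ≤ ε / 3 := by
    rw [← mul_sub, ← Finset.sum_sub_distrib, abs_mul, abs_of_pos (inv_pos.2 hn'),
      inv_mul_le_iff₀ hn']
    refine (Finset.abs_sum_le_sum_abs _ _).trans ?_
    refine (Finset.sum_le_sum fun j _ => hclose _ ((hAz z hz).1 j)).trans (by simp)
  rw [abs_le] at h1 h2 h3 ⊢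
  constructor <;> linarith

end Concentration

/-! ### Smoothness of the kernel function. -/

section Kernel

variable {μ : Measure ℝ}

lemma KernelMeasure.exists_bounds (hμ : KernelMeasure μ) :
    ∃ a b : ℝ, 0 < a ∧ a ≤ b ∧ ∀ᵐ t ∂μ, t ∈ Icc a b := by
  obtain ⟨a, b, ha, hab⟩ := hμ.support_subset
  have hae : ∀ᵐ t ∂μ, t ∈ Icc a b := by
    filter_upwards [Measure.support_mem_ae (μ := μ)] with t ht using hab ht
  have : (ae μ).NeBot := ae_neBot.2 hμ.ne_zero
  obtain ⟨t, ht⟩ := hae.exists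
  exact ⟨a, b, ha, ht.1.trans ht.2, hae⟩

/-- The negative derivative of `kernelFun μ`. -/
def kernelSlope (μ : Measure ℝ) (z : ℝ) : ℝ := ∫ t, t * Real.exp (-(t * z)) ∂μ

lemma KernelMeasure.integrable_continuous (hμ : KernelMeasure μ) {f : ℝ → ℝ} (hf : Continuous f) :
    Integrable f μ := by
  have := hμ.finite
  obtain ⟨a, b, -, -, hae⟩ := hμ.exists_bounds
  obtain ⟨C, hC⟩ := (isCompact_Icc (a := a) (b := b)).exists_bound_of_continuousOn hf.continuousOn
  exact Integrable.of_bound hf.aestronglyMeasurable C (hae.mono hC)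

lemma KernelMeasure.integrableExpSet_eq (hμ : KernelMeasure μ) :
    integrableExpSet id μ = Set.univ := by
  ext z
  simpa [integrableExpSet] using hμ.integrable_continuous (by fun_prop)

/-- As a moment generating function with all exponential moments finite, the kernel is analytic;
this supplies both its smoothness and the formula for its derivative. -/
lemma kernelFun_eq_mgf : kernelFun μ = fun z => mgf id μ (-z) := by
  ext z; simp only [kernelFun, mgf, id]; congr; ext t; ring_nf

lemma KernelMeasure.kernelSlope_eq (hμ : KernelMeasure μ) :
    kernelSlope μ = fun z => deriv (mgf id μ) (-z) := by
  ext z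
  rw [deriv_mgf (by simp [hμ.integrableExpSet_eq])]
  simp only [kernelSlope, id]; congr; ext t; ring_nf

lemma KernelMeasure.analytic_mgf (hμ : KernelMeasure μ) :
    AnalyticOnNhd ℝ (mgf id μ) Set.univ := by
  simpa [hμ.integrableExpSet_eq] using analyticOnNhd_mgf (X := id) (μ := μ)

lemma KernelMeasure.contDiff_kernelFun (hμ : KernelMeasure μ) : ContDiff ℝ 1 (kernelFun μ) := by
  rw [kernelFun_eq_mgf]
  exact (contDiffOn_univ.1 (hμ.analytic_mgf.contDiffOn uniqueDiffOn_univ)).comp contDiff_neg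

lemma KernelMeasure.hasDerivAt_kernelFun (hμ : KernelMeasure μ) (z : ℝ) :
    HasDerivAt (kernelFun μ) (-kernelSlope μ z) z := by
  rw [hμ.kernelSlope_eq, kernelFun_eq_mgf]
  have := (hμ.analytic_mgf (-z) trivial).differentiableAt.hasDerivAt.scomp z (hasDerivAt_neg z)
  simpa [Function.comp_def] using this

lemma KernelMeasure.continuous_kernelFun (hμ : KernelMeasure μ) : Continuous (kernelFun μ) :=
  hμ.contDiff_kernelFun.continuous

lemma KernelMeasure.continuous_kernelSlope (hμ : KernelMeasure μ) :
    Continuous (kernelSlope μ) := by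
  rw [hμ.kernelSlope_eq]
  have h : Continuous (deriv (mgf id μ)) := continuousOn_univ.1 hμ.analytic_mgf.deriv.continuousOn
  exact h.comp continuous_neg

end Kernel

/-! ### The objective, its slopes, and their empirical versions. -/

section Objective

/-- The integrand of `-objective`. -/
def valueKernel (q : ℕ) (μ : Measure ℝ) (β : EuclideanSpace ℝ (Fin p)) (w w' : Obs p) : ℝ :=
  w.2 * w'.2 * kernelFun μ (weightedNormPow q β (fun i => w.1 i - w'.1 i))

/-- The integrand of the partial derivative of `objective` in the direction `l`. -/
def slopeKernel (q : ℕ) (μ : Measure ℝ) (l : Fin p) (β : EuclideanSpace ℝ (Fin p))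
    (w w' : Obs p) : ℝ :=
  w.2 * w'.2 * (|w.1 l - w'.1 l| ^ q *
    kernelSlope μ (weightedNormPow q β (fun i => w.1 i - w'.1 i)))

/-- The partial derivative of `objective` in the direction `l`. -/
def objectiveSlope (q : ℕ) (μ : Measure ℝ) (Q : Measure (Obs p)) (l : Fin p)
    (β : EuclideanSpace ℝ (Fin p)) : ℝ :=
  ∫ w, slopeKernel q μ l β w.1 w.2 ∂(Q.prod Q)

lemma objective_eq (q : ℕ) (μ : Measure ℝ) (Q : Measure (Obs p)) (β : EuclideanSpace ℝ (Fin p)) :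
    objective q μ Q β = -∫ w, valueKernel q μ β w.1 w.2 ∂(Q.prod Q) := rfl

lemma continuous_weightedNormPow (q : ℕ) :
    Continuous fun x : EuclideanSpace ℝ (Fin p) × (Fin p → ℝ) => weightedNormPow q x.1 x.2 := by
  unfold weightedNormPow; fun_prop

variable {μ : Measure ℝ}

lemma continuous_valueKernel (hμ : KernelMeasure μ) (q : ℕ) :
    Continuous fun x : EuclideanSpace ℝ (Fin p) × Obs p × Obs p =>
      valueKernel q μ x.1 x.2.1 x.2.2 := by
  have h1 := hμ.continuous_kernelFun
  have h2 := (continuous_weightedNormPow (p := p) q).comp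
    (f := fun x : EuclideanSpace ℝ (Fin p) × Obs p × Obs p =>
      (x.1, fun i => x.2.1.1 i - x.2.2.1 i)) (by fun_prop)
  exact Continuous.mul (by fun_prop) (h1.comp h2)

lemma continuous_slopeKernel (hμ : KernelMeasure μ) (q : ℕ) (l : Fin p) :
    Continuous fun x : EuclideanSpace ℝ (Fin p) × Obs p × Obs p =>
      slopeKernel q μ l x.1 x.2.1 x.2.2 := by
  have h1 := hμ.continuous_kernelSlope
  have h2 := (continuous_weightedNormPow (p := p) q).comp
    (f := fun x : EuclideanSpace ℝ (Fin p) × Obs p × Obs p =>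
      (x.1, fun i => x.2.1.1 i - x.2.2.1 i)) (by fun_prop)
  exact Continuous.mul (by fun_prop) (Continuous.mul (by fun_prop) (h1.comp h2))

lemma weightedNormPow_swap (q : ℕ) (β : EuclideanSpace ℝ (Fin p)) (x x' : Fin p → ℝ) :
    weightedNormPow q β (fun i => x i - x' i) = weightedNormPow q β (fun i => x' i - x i) := by
  simp only [weightedNormPow, abs_sub_comm]

lemma valueKernel_swap (q : ℕ) (β : EuclideanSpace ℝ (Fin p)) (w w' : Obs p) :
    valueKernel q μ β w w' = valueKernel q μ β w' w := by
  simp only [valueKernel, weightedNormPow_swap q β w.1, mul_comm w.2]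

lemma slopeKernel_swap (q : ℕ) (l : Fin p) (β : EuclideanSpace ℝ (Fin p)) (w w' : Obs p) :
    slopeKernel q μ l β w w' = slopeKernel q μ l β w' w := by
  simp only [slopeKernel, weightedNormPow_swap q β w.1, mul_comm w.2, abs_sub_comm (w.1 l)]

section Empirical

variable {n : ℕ} (z : Fin n → Obs p)

lemma isProbabilityMeasure_empiricalMeasure (hn : 0 < n) :
    IsProbabilityMeasure (empiricalMeasure z) := by
  constructor
  simp only [empiricalMeasure, Measure.smul_apply, Measure.coe_finsetSum, Finset.sum_apply,
    measure_univ, Finset.sum_const, Finset.card_univ, Fintype.card_fin, nsmul_eq_mul, mul_one,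
    smul_eq_mul]
  exact ENNReal.inv_mul_cancel (by exact_mod_cast hn.ne') (by simp)

lemma integral_empiricalMeasure (f : Obs p → ℝ) :
    ∫ x, f x ∂(empiricalMeasure z) = (n : ℝ)⁻¹ * ∑ j, f (z j) := by
  rw [empiricalMeasure, integral_smul_measure, integral_finsetSum_measure
    (fun j _ => integrable_dirac (by simp))]
  simp

lemma ae_empiricalMeasure : ∀ᵐ x ∂(empiricalMeasure z), x ∈ range z := by
  refine Measure.ae_smul_measure ?_ _
  rw [ae_iff, Measure.finsetSum_apply]
  exact Finset.sum_eq_zero fun j _ => by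
    rw [← ae_iff, ae_dirac_eq]
    exact mem_range_self j

lemma integrable_empiricalMeasure_prod (hn : 0 < n) {f : Obs p × Obs p → ℝ} (hf : Continuous f) :
    Integrable f ((empiricalMeasure z).prod (empiricalMeasure z)) := by
  have := isProbabilityMeasure_empiricalMeasure z hn
  obtain ⟨C, hC⟩ := ((finite_range z).isCompact.prod (finite_range z).isCompact
    ).exists_bound_of_continuousOn hf.continuousOn
  refine Integrable.of_bound hf.aestronglyMeasurable C ?_
  have h1 := Measure.quasiMeasurePreserving_fst (μ := empiricalMeasure z)
    (ν := empiricalMeasure z) |>.ae (ae_empiricalMeasure z)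
  have h2 := Measure.quasiMeasurePreserving_snd (μ := empiricalMeasure z)
    (ν := empiricalMeasure z) |>.ae (ae_empiricalMeasure z)
  filter_upwards [h1, h2] with w hw hw' using hC w ⟨hw, hw'⟩

lemma integral_empiricalMeasure_prod (hn : 0 < n) {f : Obs p × Obs p → ℝ} (hf : Continuous f) :
    ∫ w, f w ∂((empiricalMeasure z).prod (empiricalMeasure z)) =
      (n : ℝ)⁻¹ * ∑ i, (n : ℝ)⁻¹ * ∑ j, f (z i, z j) := by
  have := isProbabilityMeasure_empiricalMeasure z hn
  rw [integral_prod f (integrable_empiricalMeasure_prod z hn hf)]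
  simp only [integral_empiricalMeasure]

/-- The linear form `β ↦ ∑ i, β i * |x i| ^ q`. -/
def weightedNormPowCLM (q : ℕ) (x : Fin p → ℝ) : EuclideanSpace ℝ (Fin p) →L[ℝ] ℝ :=
  ∑ i, |x i| ^ q • EuclideanSpace.proj i

lemma weightedNormPowCLM_apply (q : ℕ) (x : Fin p → ℝ) (β : EuclideanSpace ℝ (Fin p)) :
    weightedNormPowCLM q x β = weightedNormPow q β x := by
  simp [weightedNormPowCLM, weightedNormPow, mul_comm]

lemma weightedNormPowCLM_single (q : ℕ) (x : Fin p → ℝ) (l : Fin p) :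
    weightedNormPowCLM q x (EuclideanSpace.single l 1) = |x l| ^ q := by
  simp [weightedNormPowCLM_apply, weightedNormPow]

lemma objective_empiricalMeasure (hμ : KernelMeasure μ) (hn : 0 < n) (q : ℕ)
    (β : EuclideanSpace ℝ (Fin p)) :
    objective q μ (empiricalMeasure z) β =
      -((n : ℝ)⁻¹ * ∑ i, (n : ℝ)⁻¹ * ∑ j, (z i).2 * (z j).2 *
        kernelFun μ (weightedNormPowCLM q (fun k => (z i).1 k - (z j).1 k) β)) := by
  rw [objective_eq, integral_empiricalMeasure_prod z hn
    (f := fun w => valueKernel q μ β w.1 w.2)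
    ((continuous_valueKernel hμ q).comp (Continuous.prodMk_right β))]
  simp only [valueKernel, weightedNormPowCLM_apply]

/-- Only the empirical objective is ever differentiated, and it is a finite sum of `kernelFun` along
linear forms. The population `objectiveSlope` serves as the limit of these gradients and is never
identified with one. -/
lemma contDiff_objective_empiricalMeasure (hμ : KernelMeasure μ) (hn : 0 < n) (q : ℕ) :
    ContDiff ℝ 1 (objective q μ (empiricalMeasure z)) := by
  rw [funext (objective_empiricalMeasure z hμ hn q)]
  have := hμ.contDiff_kernelFun
  refine (contDiff_const.mul (ContDiff.sum fun i _ => contDiff_const.mul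
    (ContDiff.sum fun j _ => contDiff_const.mul ?_))).neg
  exact this.comp (ContinuousLinearMap.contDiff _)

lemma gradient_objective_empiricalMeasure (hμ : KernelMeasure μ) (hn : 0 < n) (q : ℕ)
    (β : EuclideanSpace ℝ (Fin p)) (l : Fin p) :
    gradient (objective q μ (empiricalMeasure z)) β l =
      objectiveSlope q μ (empiricalMeasure z) l β := by
  have hd : HasFDerivAt (objective q μ (empiricalMeasure z))
      (-((n : ℝ)⁻¹ • ∑ i, (n : ℝ)⁻¹ • ∑ j, ((z i).2 * (z j).2) •
        (-kernelSlope μ (weightedNormPowCLM q (fun k => (z i).1 k - (z j).1 k) β) •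
          weightedNormPowCLM q (fun k => (z i).1 k - (z j).1 k)))) β := by
    rw [funext (objective_empiricalMeasure z hμ hn q)]
    refine (HasFDerivAt.const_mul (HasFDerivAt.fun_sum fun i _ => HasFDerivAt.const_mul
      (HasFDerivAt.fun_sum fun j _ => HasFDerivAt.const_mul ?_ _) _) _).neg
    exact (hμ.hasDerivAt_kernelFun _).comp_hasFDerivAt β (ContinuousLinearMap.hasFDerivAt _)
  have hg : gradient (objective q μ (empiricalMeasure z)) β l =
      fderiv ℝ (objective q μ (empiricalMeasure z)) β (EuclideanSpace.single l 1) := by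
    have h : inner ℝ (gradient (objective q μ (empiricalMeasure z)) β)
        (EuclideanSpace.single l (1 : ℝ)) =
        fderiv ℝ (objective q μ (empiricalMeasure z)) β (EuclideanSpace.single l 1) :=
      InnerProductSpace.toDual_symm_apply
    rw [← h, EuclideanSpace.inner_single_right]; simp
  rw [hg, hd.fderiv, objectiveSlope, integral_empiricalMeasure_prod z hn
    (f := fun w => slopeKernel q μ l β w.1 w.2)
    ((continuous_slopeKernel hμ q l).comp (Continuous.prodMk_right β))]
  simp only [neg_apply, smul_apply, sum_apply, weightedNormPowCLM_single, smul_eq_mul,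
    slopeKernel]
  simp only [weightedNormPowCLM_apply]
  rw [← mul_neg, ← Finset.sum_neg_distrib]
  congr 1
  refine Finset.sum_congr rfl fun i _ => ?_
  rw [← mul_neg, ← Finset.sum_neg_distrib]
  congr 1
  refine Finset.sum_congr rfl fun j _ => ?_
  ring

end Empirical

end Objective

/-! ### Convolution roots of the exponential kernels. -/

section Roots

/-- `ψ` is a nonnegative bounded integrable function without zeros of its Fourier transform, and
the kernel `k (x - x')` is the superposition of the rank one kernels `ψ (x - u) * ψ (x' - u)`. -/
structure ConvolutionRoot {V : Type*} [NormedAddCommGroup V] [NormedSpace ℝ V] [MeasureSpace V]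
    (ψ k : V → ℝ) : Prop where
  measurable : Measurable ψ
  integrable : Integrable ψ
  nonneg : ∀ s, 0 ≤ ψ s
  bounded : ∃ C, ∀ s, ψ s ≤ C
  convolution : ∀ x x', ∫ u, ψ (x - u) * ψ (x' - u) = k (x - x')
  fourier_ne_zero : ∀ L : StrongDual ℝ V, ∫ s, Complex.exp (L s * Complex.I) * (ψ s : ℂ) ≠ 0

/-- Everything tensorises: a linear functional is the sum of its coordinate parts, so the Fourier
integral, like the convolution integral, factors over the coordinates. -/
lemma ConvolutionRoot.pi {p : ℕ} {ψ k : Fin p → ℝ → ℝ} (h : ∀ i, ConvolutionRoot (ψ i) (k i)) :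
    ConvolutionRoot (fun s : Fin p → ℝ => ∏ i, ψ i (s i)) (fun s => ∏ i, k i (s i)) where
  measurable := Finset.measurable_prod _ fun i _ => (h i).measurable.comp (measurable_pi_apply i)
  integrable := Integrable.fintype_prod fun i => (h i).integrable
  nonneg s := Finset.prod_nonneg fun i _ => (h i).nonneg _
  bounded := by
    choose C hC using fun i => (h i).bounded
    exact ⟨∏ i, C i, fun s => Finset.prod_le_prod (fun i _ => (h i).nonneg _) fun i _ => hC i _⟩
  convolution x x' := by
    simp only [← Finset.prod_mul_distrib, Pi.sub_apply]
    rw [integral_fintype_prod_volume_eq_prod (fun i u => ψ i (x i - u) * ψ i (x' i - u))]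
    exact Finset.prod_congr rfl fun i _ => (h i).convolution _ _
  fourier_ne_zero L := by
    have e : ∀ s : Fin p → ℝ, Complex.exp (L s * Complex.I) * ((∏ i, ψ i (s i) : ℝ) : ℂ) =
        ∏ i, Complex.exp (((L (Pi.single i 1) • ContinuousLinearMap.id ℝ ℝ : StrongDual ℝ ℝ)
          (s i) : ℂ) * Complex.I) * (ψ i (s i) : ℂ) := fun s => by
      rw [Finset.prod_mul_distrib, ← Complex.exp_sum, ← Finset.sum_mul]
      have hL : L s = ∑ i, L (Pi.single i 1) * s i := by
        have hs : s = ∑ i, s i • (Pi.single i (1 : ℝ) : Fin p → ℝ) := by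
          ext j; simp [Finset.sum_apply, Pi.single_apply]
        conv_lhs => rw [hs]
        simp [map_sum, mul_comm]
      rw [hL]
      push_cast
      simp
    simp only [e]
    rw [integral_fintype_prod_volume_eq_prod (fun i u => Complex.exp (((L (Pi.single i 1) •
      ContinuousLinearMap.id ℝ ℝ : StrongDual ℝ ℝ) u : ℂ) * Complex.I) * (ψ i u : ℂ))]
    exact Finset.prod_ne_zero_iff.2 fun i _ => (h i).fourier_ne_zero _

lemma strongDual_real_apply (L : StrongDual ℝ ℝ) (s : ℝ) : L s = L 1 * s := by
  have := L.map_smul s 1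
  simpa [mul_comm] using this

/-- Completing the square, `2b(x-u)² + 2b(x'-u)² = b(x-x')² + 4b(u-(x+x')/2)²`; the prefactor
normalises the remaining Gaussian integral. -/
lemma convolutionRoot_gaussian {b : ℝ} (hb : 0 < b) :
    ConvolutionRoot (fun s => √(√(4 * b / Real.pi)) * Real.exp (-(2 * b) * s ^ 2))
      (fun s => Real.exp (-(b * s ^ 2))) where
  measurable := by fun_prop
  integrable := (integrable_exp_neg_mul_sq (by positivity)).const_mul _
  nonneg s := by positivity
  bounded := ⟨√(√(4 * b / Real.pi)), fun s => mul_le_of_le_one_right (by positivity)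
    (Real.exp_le_one_iff.2 (by nlinarith [mul_nonneg hb.le (sq_nonneg s)]))⟩
  convolution x x' := by
    have e : ∀ u, √(√(4 * b / Real.pi)) * Real.exp (-(2 * b) * (x - u) ^ 2) *
        (√(√(4 * b / Real.pi)) * Real.exp (-(2 * b) * (x' - u) ^ 2)) =
        (√(4 * b / Real.pi) * Real.exp (-(b * (x - x') ^ 2))) *
          Real.exp (-(4 * b) * (u - (x + x') / 2) ^ 2) := fun u => by
      rw [mul_mul_mul_comm, Real.mul_self_sqrt (Real.sqrt_nonneg _), ← Real.exp_add, mul_assoc,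
        ← Real.exp_add]
      congr 2; ring
    simp only [e]
    rw [integral_const_mul, integral_sub_right_eq_self
      (fun u => Real.exp (-(4 * b) * u ^ 2)) ((x + x') / 2), integral_gaussian, mul_right_comm,
      ← Real.sqrt_mul (by positivity)]
    have : 4 * b / Real.pi * (Real.pi / (4 * b)) = 1 := by
      have := Real.pi_pos; field_simp
    rw [this]; simp
  fourier_ne_zero L := by
    have h := fourierIntegral_gaussian (b := ((2 * b : ℝ) : ℂ)) (by simpa using hb) ((L 1 : ℝ) : ℂ)
    have e : ∀ s : ℝ, Complex.exp (L s * Complex.I) *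
        ((√(√(4 * b / Real.pi)) * Real.exp (-(2 * b) * s ^ 2) : ℝ) : ℂ) =
        ((√(√(4 * b / Real.pi)) : ℝ) : ℂ) * (Complex.exp (Complex.I * (L 1 : ℝ) * s) *
          Complex.exp (-((2 * b : ℝ) : ℂ) * s ^ 2)) := fun s => by
      rw [strongDual_real_apply L s]
      push_cast
      ring_nf
    simp only [e]
    rw [integral_const_mul, h]
    refine mul_ne_zero ?_ (mul_ne_zero ?_ (Complex.exp_ne_zero _))
    · have : 0 < √(√(4 * b / Real.pi)) := by have := Real.pi_pos; positivity
      exact_mod_cast this.ne'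
    · rw [Ne, Complex.cpow_eq_zero_iff]
      simp [Real.pi_ne_zero, hb.ne']

/-- The one-sided exponential suffices: the product of two translates lives on `u ≤ min x x'`, and
`x + x' - 2 * min x x' = |x - x'|`. Its transform is a multiple of `1 / (b - iξ)`, visibly without
zeros. -/
lemma convolutionRoot_exponential {b : ℝ} (hb : 0 < b) :
    ConvolutionRoot ((Ici 0).indicator fun s => √(2 * b) * Real.exp (-b * s))
      (fun s => Real.exp (-(b * |s|))) where
  measurable := Measurable.indicator (by fun_prop) measurableSet_Ici
  integrable := by
    rw [integrable_indicator_iff measurableSet_Ici, integrableOn_Ici_iff_integrableOn_Ioi]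
    exact (integrableOn_exp_mul_Ioi (by linarith) 0).const_mul _
  nonneg s := indicator_nonneg (fun _ _ => by positivity) _
  bounded := ⟨√(2 * b), fun s => by
    refine indicator_le' (g := fun _ => √(2 * b)) (fun s hs => ?_) (fun _ _ => by positivity) s
    refine mul_le_of_le_one_right (by positivity) (Real.exp_le_one_iff.2 ?_)
    have : (0 : ℝ) ≤ s := hs
    nlinarith⟩
  convolution x x' := by
    have e : ∀ u, (Ici 0).indicator (fun s => √(2 * b) * Real.exp (-b * s)) (x - u) *
        (Ici 0).indicator (fun s => √(2 * b) * Real.exp (-b * s)) (x' - u) =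
        (Iic (min x x')).indicator
          (fun u => (2 * b * Real.exp (-b * (x + x'))) * Real.exp (2 * b * u)) u := fun u => by
      by_cases hu : u ≤ min x x'
      · have h1 := le_min_iff.1 hu
        rw [indicator_of_mem (show x - u ∈ Ici 0 from sub_nonneg.2 h1.1),
          indicator_of_mem (show x' - u ∈ Ici 0 from sub_nonneg.2 h1.2),
          indicator_of_mem (show u ∈ Iic (min x x') from hu), mul_mul_mul_comm,
          Real.mul_self_sqrt (by positivity), ← Real.exp_add, mul_assoc (2 * b), ← Real.exp_add]
        congr 2; ring
      · rw [indicator_of_notMem (show u ∉ Iic (min x x') from hu)]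
        rw [le_min_iff, not_and_or] at hu
        rcases hu with hu | hu
        · rw [indicator_of_notMem (show x - u ∉ Ici 0 from fun h => hu (sub_nonneg.1 h)), zero_mul]
        · rw [indicator_of_notMem (show x' - u ∉ Ici 0 from fun h => hu (sub_nonneg.1 h)), mul_zero]
    simp only [e]
    rw [integral_indicator measurableSet_Iic, integral_const_mul,
      integral_exp_mul_Iic (by positivity)]
    have h2 : 2 * b * Real.exp (-b * (x + x')) * (Real.exp (2 * b * min x x') / (2 * b)) =
        Real.exp (-b * (x + x')) * Real.exp (2 * b * min x x') := by field_simp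
    rw [h2, ← Real.exp_add]
    congr 1
    rcases le_total x x' with h | h
    · rw [min_eq_left h, abs_of_nonpos (by linarith)]; ring
    · rw [min_eq_right h, abs_of_nonneg (by linarith)]; ring
  fourier_ne_zero L := by
    have e : ∀ s : ℝ, Complex.exp (L s * Complex.I) *
        (((Ici 0).indicator (fun s => √(2 * b) * Real.exp (-b * s)) s : ℝ) : ℂ) =
        (Ici 0).indicator (fun s : ℝ => ((√(2 * b) : ℝ) : ℂ) *
          Complex.exp ((-(b : ℂ) + (L 1 : ℝ) * Complex.I) * s)) s := fun s => by
      by_cases hs : s ∈ Ici (0 : ℝ)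
      · rw [indicator_of_mem hs, indicator_of_mem hs, strongDual_real_apply L s, add_mul,
          Complex.exp_add]
        push_cast
        ring_nf
      · rw [indicator_of_notMem hs, indicator_of_notMem hs]; simp
    simp only [e]
    have hre : (-(b : ℂ) + (L 1 : ℝ) * Complex.I).re < 0 := by simpa using hb
    rw [integral_indicator measurableSet_Ici, integral_const_mul, integral_Ici_eq_integral_Ioi,
      integral_exp_mul_complex_Ioi hre]
    have h0 : (-(b : ℂ) + (L 1 : ℝ) * Complex.I) ≠ 0 := fun h => by rw [h] at hre; simp at hre
    refine mul_ne_zero ?_ (div_ne_zero (neg_ne_zero.2 (Complex.exp_ne_zero _)) h0)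
    have : 0 < √(2 * b) := by positivity
    exact_mod_cast this.ne'

/-- The kernels `exp (-∑ i, b i * |x i - x' i| ^ q)` with positive weights have a convolution
root. -/
lemma exists_convolutionRoot {p q : ℕ} (hq : q = 1 ∨ q = 2) {b : Fin p → ℝ} (hb : ∀ i, 0 < b i) :
    ∃ ψ : (Fin p → ℝ) → ℝ, ConvolutionRoot ψ fun s => Real.exp (-∑ i, b i * |s i| ^ q) := by
  have h1 : ∀ i, ∃ ψ : ℝ → ℝ, ConvolutionRoot ψ fun s => Real.exp (-(b i * |s| ^ q)) := fun i => by
    rcases hq with rfl | rfl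
    · exact ⟨_, by simpa using convolutionRoot_exponential (hb i)⟩
    · exact ⟨_, by simpa using convolutionRoot_gaussian (hb i)⟩
  choose ψ hψ using h1
  refine ⟨fun s => ∏ i, ψ i (s i), ?_⟩
  simpa only [← Real.exp_sum, Finset.sum_neg_distrib] using ConvolutionRoot.pi hψ

end Roots

/-! ### Positive semidefiniteness of the exponential kernels. -/

section Positivity

variable {Q : Measure (Obs p)} [IsProbabilityMeasure Q] {ψ k : (Fin p → ℝ) → ℝ} {MY : ℝ}

/-- The pairing of the response with the translates of a root. -/
def rootMean (Q : Measure (Obs p)) (ψ : (Fin p → ℝ) → ℝ) (u : Fin p → ℝ) : ℝ :=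
  ∫ z, z.2 * ψ (z.1 - u) ∂Q

lemma ConvolutionRoot.integrable_prod (h : ConvolutionRoot ψ k) {Ω : Type*} [MeasurableSpace Ω]
    (P : Measure Ω) [IsFiniteMeasure P] {X : Ω → Fin p → ℝ} (hX : Measurable X) :
    Integrable (fun w : Ω × (Fin p → ℝ) => ψ (X w.1 - w.2)) (P.prod volume) := by
  have hm := h.measurable
  have hm' : Measurable fun w : Ω × (Fin p → ℝ) => ψ (X w.1 - w.2) := hm.comp (by fun_prop)
  rw [integrable_prod_iff hm'.aestronglyMeasurable]
  refine ⟨ae_of_all _ fun w => h.integrable.comp_sub_left (X w), ?_⟩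
  have e : ∀ w, ∫ u, ‖ψ (X w - u)‖ = ∫ u, ‖ψ u‖ := fun w =>
    integral_sub_left_eq_self (fun u => ‖ψ u‖) volume (X w)
  simp only [e]
  exact integrable_const _

/-- After inserting the convolution formula and exchanging integrals, independence factors the
expectation at each `u` into a square. Fubini applies because one copy of `ψ` is bounded and the
other integrable. -/
lemma ConvolutionRoot.integral_prod_eq (h : ConvolutionRoot ψ k) (hY : ∀ᵐ z ∂Q, |z.2| ≤ MY) :
    Integrable (fun u => rootMean Q ψ u ^ 2) ∧
    ∫ w, w.1.2 * w.2.2 * k (w.1.1 - w.2.1) ∂(Q.prod Q) = ∫ u, rootMean Q ψ u ^ 2 := by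
  have hm := h.measurable
  obtain ⟨C, hC⟩ := h.bounded
  have hC0 : 0 ≤ C := (h.nonneg 0).trans (hC 0)
  let f : (Obs p × Obs p) × (Fin p → ℝ) → ℝ := fun w =>
    (w.1.1.2 * ψ (w.1.1.1 - w.2)) * (w.1.2.2 * ψ (w.1.2.1 - w.2))
  have hf : Integrable f ((Q.prod Q).prod volume) := by
    have h1 := (h.integrable_prod (Q.prod Q) (X := fun w => w.1.1) (by fun_prop)).const_mul
      (MY * (MY * C))
    refine h1.mono' (by fun_prop) ?_
    have a1 := (Measure.quasiMeasurePreserving_fst (μ := Q) (ν := Q)).ae hY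
    have a2 := (Measure.quasiMeasurePreserving_snd (μ := Q) (ν := Q)).ae hY
    have a3 := (Measure.quasiMeasurePreserving_fst (μ := Q.prod Q)
      (ν := (volume : Measure (Fin p → ℝ)))).ae (a1.and a2)
    filter_upwards [a3] with w hw
    have hMY : 0 ≤ MY := (abs_nonneg _).trans hw.1
    have p1 := h.nonneg (w.1.1.1 - w.2)
    have p2 := h.nonneg (w.1.2.1 - w.2)
    simp only [f, norm_mul, Real.norm_eq_abs, abs_of_nonneg p1, abs_of_nonneg p2]
    calc |w.1.1.2| * ψ (w.1.1.1 - w.2) * (|w.1.2.2| * ψ (w.1.2.1 - w.2))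
        ≤ MY * ψ (w.1.1.1 - w.2) * (MY * C) := by
          gcongr
          · exact hw.1
          · exact hw.2
          · exact hC _
      _ = _ := by ring
  have e1 : ∀ u, ∫ w, f (w, u) ∂(Q.prod Q) = rootMean Q ψ u ^ 2 := fun u => by
    rw [pow_two]
    exact integral_prod_mul (fun z : Obs p => z.2 * ψ (z.1 - u)) (fun z : Obs p => z.2 * ψ (z.1 - u))
  constructor
  · simpa only [e1] using hf.integral_prod_right
  · have e2 : ∀ w : Obs p × Obs p, w.1.2 * w.2.2 * k (w.1.1 - w.2.1) = ∫ u, f (w, u) := fun w => by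
      rw [← h.convolution, ← integral_const_mul]
      congr; ext u; simp only [f]; ring
    simp only [e2, ← e1]
    exact integral_integral_swap hf

lemma integral_weighted_nonneg_of_pos {q : ℕ} (hq : q = 1 ∨ q = 2) {b : Fin p → ℝ}
    (hb : ∀ i, 0 < b i) (hY : ∀ᵐ z ∂Q, |z.2| ≤ MY) :
    0 ≤ ∫ w, w.1.2 * w.2.2 * Real.exp (-∑ i, b i * |w.1.1 i - w.2.1 i| ^ q) ∂(Q.prod Q) := by
  obtain ⟨ψ, hψ⟩ := exists_convolutionRoot hq hb
  have := (hψ.integral_prod_eq hY).2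
  simp only [Pi.sub_apply] at this
  rw [this]
  exact integral_nonneg fun u => sq_nonneg _

/-- The exponential kernels are positive semidefinite. -/
lemma integral_weighted_nonneg {q : ℕ} (hq : q = 1 ∨ q = 2) {b : Fin p → ℝ}
    (hb : ∀ i, 0 ≤ b i) (hY : ∀ᵐ z ∂Q, |z.2| ≤ MY) :
    0 ≤ ∫ w, w.1.2 * w.2.2 * Real.exp (-∑ i, b i * |w.1.1 i - w.2.1 i| ^ q) ∂(Q.prod Q) := by
  have a1 := (Measure.quasiMeasurePreserving_fst (μ := Q) (ν := Q)).ae hY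
  have a2 := (Measure.quasiMeasurePreserving_snd (μ := Q) (ν := Q)).ae hY
  -- Roots require strictly positive weights; vanishing weights are reached as a limit. They occur
  -- later, when the kernel is restricted to the features of `S`.
  have hlim : Tendsto (fun n : ℕ => ∫ w, w.1.2 * w.2.2 *
      Real.exp (-∑ i, (b i + 1 / ((n : ℝ) + 1)) * |w.1.1 i - w.2.1 i| ^ q) ∂(Q.prod Q)) atTop
      (𝓝 (∫ w, w.1.2 * w.2.2 *
        Real.exp (-∑ i, (b i + 0) * |w.1.1 i - w.2.1 i| ^ q) ∂(Q.prod Q))) := by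
    refine tendsto_integral_of_dominated_convergence (fun _ => MY * MY)
      (fun n => by fun_prop) (integrable_const _) (fun n => ?_) (ae_of_all _ fun w => ?_)
    · filter_upwards [a1, a2] with w h1 h2
      have hMY : 0 ≤ MY := (abs_nonneg _).trans h1
      rw [norm_mul, norm_mul, Real.norm_eq_abs, Real.norm_eq_abs, Real.norm_eq_abs, Real.abs_exp]
      refine (mul_le_of_le_one_right (by positivity) ?_).trans (mul_le_mul h1 h2 (abs_nonneg _) hMY)
      refine Real.exp_le_one_iff.2 (neg_nonpos.2 (Finset.sum_nonneg fun i _ => ?_))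
      have := hb i
      positivity
    · refine Tendsto.const_mul _ ((Real.continuous_exp.tendsto _).comp (Tendsto.neg
        (tendsto_finsetSum _ fun i _ => Tendsto.mul_const _ (Tendsto.const_add _ ?_))))
      exact tendsto_one_div_add_atTop_nhds_zero_nat
  simp only [add_zero] at hlim
  refine ge_of_tendsto' hlim fun n => integral_weighted_nonneg_of_pos hq (fun i => ?_) hY
  have := hb i
  positivity

end Positivity

/-! ### Strict positivity by Fourier uniqueness. -/

section Strictness

variable {Q : Measure (Obs p)} [IsProbabilityMeasure Q] {ψ k : (Fin p → ℝ) → ℝ} {MY : ℝ}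

/-- `rootMean` is the convolution of the signed law of `X` weighted by `Y` with the reflected root.
Its transform is a product, and the factor coming from `ψ` never vanishes. -/
lemma ConvolutionRoot.fourier_eq_zero (h : ConvolutionRoot ψ k) (hY : ∀ᵐ z ∂Q, |z.2| ≤ MY)
    (h0 : rootMean Q ψ =ᵐ[volume] 0) (L : StrongDual ℝ (Fin p → ℝ)) :
    ∫ z, Complex.exp (L z.1 * Complex.I) * (z.2 : ℂ) ∂Q = 0 := by
  have hm := h.measurable
  let f : Obs p × (Fin p → ℝ) → ℂ := fun w =>
    Complex.exp (L w.2 * Complex.I) * ((w.1.2 * ψ (w.1.1 - w.2) : ℝ) : ℂ)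
  have hf : Integrable f (Q.prod volume) := by
    have h1 := (h.integrable_prod Q (X := fun w => w.1) (by fun_prop)).const_mul MY
    refine h1.mono' (by fun_prop) ?_
    have a1 := (Measure.quasiMeasurePreserving_fst (μ := Q)
      (ν := (volume : Measure (Fin p → ℝ)))).ae hY
    filter_upwards [a1] with w hw
    simp only [f, norm_mul, Complex.norm_exp_ofReal_mul_I, Complex.norm_real, one_mul,
      Real.norm_eq_abs, abs_of_nonneg (h.nonneg _)]
    exact mul_le_mul_of_nonneg_right hw (h.nonneg _)
  have e1 : ∀ u, ∫ z, f (z, u) ∂Q = Complex.exp (L u * Complex.I) * (rootMean Q ψ u : ℂ) :=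
    fun u => by
      simp only [f, rootMean]
      rw [integral_const_mul, integral_complex_ofReal]
  have e2 : ∀ z : Obs p, ∫ u, f (z, u) = (Complex.exp (L z.1 * Complex.I) * (z.2 : ℂ)) *
      ∫ s, Complex.exp ((-L) s * Complex.I) * (ψ s : ℂ) := fun z => by
    rw [← integral_sub_left_eq_self (fun s => Complex.exp ((-L) s * Complex.I) * (ψ s : ℂ))
      volume z.1, ← integral_const_mul]
    congr; ext u
    simp only [f, neg_apply, map_sub]
    have h3 : Complex.exp (L u * Complex.I) = Complex.exp (L z.1 * Complex.I) *
        Complex.exp ((-(L z.1 - L u) : ℝ) * Complex.I) := by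
      rw [← Complex.exp_add]; congr 1; push_cast; ring
    rw [h3]
    push_cast
    ring_nf
  have h2 := integral_integral_swap (f := fun z u => f (z, u)) hf
  simp only [e1, e2] at h2
  rw [integral_mul_const] at h2
  have h3 : ∫ u, Complex.exp (L u * Complex.I) * (rootMean Q ψ u : ℂ) = 0 := by
    refine integral_eq_zero_of_ae ?_
    filter_upwards [h0] with u hu
    simp [hu]
  rw [h3] at h2
  exact (mul_eq_zero.1 h2).resolve_right (h.fourier_ne_zero (-L))

/-- If all Fourier coefficients of the response vanish then the response has conditional mean
zero given the features. -/
lemma condExp_eq_zero_of_fourier (hY : ∀ᵐ z ∂Q, |z.2| ≤ MY)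
    (h0 : ∀ L : StrongDual ℝ (Fin p → ℝ),
      ∫ z, Complex.exp (L z.1 * Complex.I) * (z.2 : ℂ) ∂Q = 0) :
    Q[fun z : Obs p => z.2 | MeasurableSpace.comap (fun z : Obs p => z.1) inferInstance]
      =ᵐ[Q] 0 := by
  have hint : Integrable (fun z : Obs p => z.2) Q :=
    Integrable.of_bound (by fun_prop) MY hY
  have hle : MeasurableSpace.comap (fun z : Obs p => z.1) inferInstance ≤
      (inferInstance : MeasurableSpace (Obs p)) := measurable_fst.comap_le
  -- Shifting the response by `MY` replaces a signed measure by two positive ones, with densities `y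
  -- + MY` and `MY`, to which uniqueness of characteristic functions applies.
  let d : ℝ → ℝ≥0∞ := fun y => ENNReal.ofReal (y + MY)
  let P₁ : Measure (Fin p → ℝ) := (Q.withDensity fun z => d z.2).map Prod.fst
  let P₂ : Measure (Fin p → ℝ) := (Q.withDensity fun _ => d 0).map Prod.fst
  have hMY : 0 ≤ MY := by
    obtain ⟨z, hz⟩ := hY.exists
    exact (abs_nonneg _).trans hz
  have hd : Measurable fun z : Obs p => d z.2 := by fun_prop
  have hint1 : Integrable (fun z : Obs p => z.2 + MY) Q := hint.add (integrable_const _)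
  have f1 : IsFiniteMeasure (Q.withDensity fun z => d z.2) :=
    isFiniteMeasure_withDensity_ofReal hint1.2
  have f2 : IsFiniteMeasure (Q.withDensity fun _ => d 0) :=
    isFiniteMeasure_withDensity_ofReal (integrable_const (0 + MY)).2
  have key : P₁ = P₂ := by
    refine Measure.ext_of_charFunDual ?_
    ext L
    rw [charFunDual_apply, charFunDual_apply, integral_map (by fun_prop) (by fun_prop),
      integral_map (by fun_prop) (by fun_prop),
      integral_withDensity_eq_integral_toReal_smul hd (by simp [d]),
      integral_withDensity_eq_integral_toReal_smul (by fun_prop) (by simp [d])]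
    have hexp : Integrable (fun z : Obs p => Complex.exp (L z.1 * Complex.I)) Q :=
      Integrable.of_bound (by fun_prop) 1 (ae_of_all _ fun z => by
        rw [Complex.norm_exp_ofReal_mul_I])
    have hexp2 : Integrable (fun z : Obs p => Complex.exp (L z.1 * Complex.I) * (z.2 : ℂ)) Q :=
      Integrable.of_bound (by fun_prop) MY (hY.mono fun z hz => by
        rw [norm_mul, Complex.norm_exp_ofReal_mul_I, one_mul, Complex.norm_real]; exact hz)
    have e : ∫ z, (d z.2).toReal • Complex.exp (L z.1 * Complex.I) ∂Q =
        ∫ z, (Complex.exp (L z.1 * Complex.I) * (z.2 : ℂ) +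
          (d 0).toReal • Complex.exp (L z.1 * Complex.I)) ∂Q := by
      refine integral_congr_ae (hY.mono fun z hz => ?_)
      have := (abs_le.1 hz).1
      simp only [d, Complex.real_smul]
      rw [ENNReal.toReal_ofReal (by linarith), ENNReal.toReal_ofReal (by linarith)]
      push_cast; ring
    rw [e]
    refine (integral_add hexp2 (hexp.smul (d 0).toReal)).trans ?_
    rw [h0 L, zero_add]
    rfl
  symm
  refine ae_eq_condExp_of_forall_setIntegral_eq hle hint (fun _ _ _ => integrableOn_zero) ?_
    aestronglyMeasurable_zero
  rintro _ ⟨A, hA, rfl⟩ -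
  have hA' : MeasurableSet ((fun z : Obs p => z.1) ⁻¹' A) := measurable_fst hA
  have h1 : P₁ A = P₂ A := by rw [key]
  simp only [P₁, P₂] at h1
  rw [Measure.map_apply measurable_fst hA, Measure.map_apply measurable_fst hA,
    withDensity_apply _ (measurable_fst hA), withDensity_apply _ (measurable_fst hA)] at h1
  simp only [d] at h1
  rw [← ofReal_integral_eq_lintegral_ofReal hint1.integrableOn
      (ae_restrict_of_ae (hY.mono fun z hz => by
        have := (abs_le.1 hz).1
        simp only [Pi.zero_apply]; linarith)),
    ← ofReal_integral_eq_lintegral_ofReal (integrable_const _)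
      (ae_of_all _ fun z => by simpa using hMY),
    ENNReal.ofReal_eq_ofReal_iff
      (integral_nonneg_of_ae (ae_restrict_of_ae (hY.mono fun z hz => by
        have := (abs_le.1 hz).1
        simp only [Pi.zero_apply]; linarith)))
      (integral_nonneg fun z => by simpa using hMY),
    integral_add hint.integrableOn (integrable_const _)] at h1
  simp only [zero_add, add_eq_right] at h1
  simpa using h1.symm

/-- The empty subvector is constant and generates the trivial σ-algebra, where the conditional mean
is `E Y = 0`. -/
lemma fullPredictivePower_empty_of_fourier (hY : ∀ᵐ z ∂Q, |z.2| ≤ MY)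
    (hc : ∫ z, z.2 ∂Q = 0)
    (h0 : ∀ L : StrongDual ℝ (Fin p → ℝ),
      ∫ z, Complex.exp (L z.1 * Complex.I) * (z.2 : ℂ) ∂Q = 0) :
    FullPredictivePower Q ∅ := by
  refine (condExp_eq_zero_of_fourier hY h0).trans ?_
  have h1 : subFeatures (p := p) ∅ = fun _ => isEmptyElim := by
    ext z i; exact absurd i.2 (Finset.notMem_empty _)
  rw [h1, MeasurableSpace.comap_const, condExp_bot, hc]
  rfl

end Strictness

/-! ### Covariance bounds from the maximal correlation. -/

section MaximalCorrelation

variable {Ω : Type*} [MeasurableSpace Ω] {P : Measure Ω} [IsProbabilityMeasure P]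

/-- `Var (X + c Y)` is a nonnegative quadratic in `c`, so its discriminant is nonpositive. -/
lemma covariance_sq_le {X Y : Ω → ℝ} (hX : MemLp X 2 P) (hY : MemLp Y 2 P) :
    covariance X Y P ^ 2 ≤ variance X P * variance Y P := by
  have h : ∀ c : ℝ, 0 ≤ variance Y P * (c * c) + 2 * covariance X Y P * c + variance X P := by
    intro c
    have h1 := variance_nonneg (X + c • Y) P
    rw [variance_add hX (hY.const_smul c), variance_smul, covariance_smul_right] at h1
    linarith
  have := discrim_le_zero h
  rw [discrim] at this
  linarith

variable {α₁ α₂ : Type*} [MeasurableSpace α₁] [MeasurableSpace α₂] {W₁ : Ω → α₁} {W₂ : Ω → α₂}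

lemma abs_correlation_le_one {X Y : Ω → ℝ} (hX : MemLp X 2 P) (hY : MemLp Y 2 P)
    (hX0 : 0 < variance X P) (hY0 : 0 < variance Y P) :
    |covariance X Y P / √(variance X P * variance Y P)| ≤ 1 := by
  rw [abs_div, abs_of_nonneg (Real.sqrt_nonneg _), div_le_one (by positivity)]
  exact Real.abs_le_sqrt (covariance_sq_le hX hY)

lemma maximalCorrelation_bddAbove (P : Measure Ω) [IsProbabilityMeasure P] (W₁ : Ω → α₁)
    (W₂ : Ω → α₂) :
    BddAbove {r : ℝ | ∃ (g₁ : α₁ → ℝ) (g₂ : α₂ → ℝ), Measurable g₁ ∧ Measurable g₂ ∧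
      MemLp (fun ω => g₁ (W₁ ω)) 2 P ∧ MemLp (fun ω => g₂ (W₂ ω)) 2 P ∧
      0 < variance (fun ω => g₁ (W₁ ω)) P ∧ 0 < variance (fun ω => g₂ (W₂ ω)) P ∧
      r = covariance (fun ω => g₁ (W₁ ω)) (fun ω => g₂ (W₂ ω)) P /
        Real.sqrt (variance (fun ω => g₁ (W₁ ω)) P * variance (fun ω => g₂ (W₂ ω)) P)} := by
  refine ⟨1, ?_⟩
  rintro r ⟨g₁, g₂, -, -, h1, h2, v1, v2, rfl⟩
  exact (le_abs_self _).trans (abs_correlation_le_one h1 h2 v1 v2)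

lemma abs_covariance_le_maximalCorrelation_of_pos {g₁ : α₁ → ℝ} {g₂ : α₂ → ℝ}
    (hg₁ : Measurable g₁) (hg₂ : Measurable g₂)
    (h1 : MemLp (fun ω => g₁ (W₁ ω)) 2 P) (h2 : MemLp (fun ω => g₂ (W₂ ω)) 2 P)
    (v1 : 0 < variance (fun ω => g₁ (W₁ ω)) P) (v2 : 0 < variance (fun ω => g₂ (W₂ ω)) P) :
    |covariance (fun ω => g₁ (W₁ ω)) (fun ω => g₂ (W₂ ω)) P| ≤ maximalCorrelation P W₁ W₂ *
      √(variance (fun ω => g₁ (W₁ ω)) P * variance (fun ω => g₂ (W₂ ω)) P) := by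
  have hs : 0 < √(variance (fun ω => g₁ (W₁ ω)) P * variance (fun ω => g₂ (W₂ ω)) P) := by
    positivity
  have hbdd := maximalCorrelation_bddAbove P W₁ W₂
  have e1 := le_csSup hbdd ⟨g₁, g₂, hg₁, hg₂, h1, h2, v1, v2, rfl⟩
  -- The defining supremum has no absolute value; replacing `g₁` by `-g₁` supplies the lower bound.
  have e2 := le_csSup hbdd ⟨fun x => -g₁ x, g₂, hg₁.neg, hg₂, h1.neg, h2,
    by rwa [variance_fun_neg], v2, rfl⟩
  rw [covariance_fun_neg_left, variance_fun_neg, neg_div] at e2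
  have e3 : |covariance (fun ω => g₁ (W₁ ω)) (fun ω => g₂ (W₂ ω)) P /
      √(variance (fun ω => g₁ (W₁ ω)) P * variance (fun ω => g₂ (W₂ ω)) P)| ≤
      maximalCorrelation P W₁ W₂ := abs_le.2 ⟨by rw [maximalCorrelation]; linarith, e1⟩
  rwa [abs_div, abs_of_pos hs, div_le_iff₀ hs] at e3

lemma maximalCorrelation_nonneg (P : Measure Ω) [IsProbabilityMeasure P] (W₁ : Ω → α₁)
    (W₂ : Ω → α₂) : 0 ≤ maximalCorrelation P W₁ W₂ := by
  by_cases hne : ∃ (g₁ : α₁ → ℝ) (g₂ : α₂ → ℝ), Measurable g₁ ∧ Measurable g₂ ∧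
      MemLp (fun ω => g₁ (W₁ ω)) 2 P ∧ MemLp (fun ω => g₂ (W₂ ω)) 2 P ∧
      0 < variance (fun ω => g₁ (W₁ ω)) P ∧ 0 < variance (fun ω => g₂ (W₂ ω)) P
  · obtain ⟨g₁, g₂, m1, m2, h1, h2, v1, v2⟩ := hne
    have := (abs_nonneg _).trans
      (abs_covariance_le_maximalCorrelation_of_pos m1 m2 h1 h2 v1 v2)
    have hs : 0 < √(variance (fun ω => g₁ (W₁ ω)) P * variance (fun ω => g₂ (W₂ ω)) P) := by
      positivity
    exact nonneg_of_mul_nonneg_left this hs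
  · refine (Real.sSup_empty.symm.trans (congrArg sSup ?_)).le
    refine (eq_empty_of_forall_notMem ?_).symm
    rintro r ⟨g₁, g₂, m1, m2, h1, h2, v1, v2, -⟩
    exact hne ⟨g₁, g₂, m1, m2, h1, h2, v1, v2⟩

lemma variance_le_sq_of_ae_bound {X : Ω → ℝ} (hX : AEMeasurable X P) {B : ℝ}
    (hB : ∀ᵐ ω ∂P, |X ω| ≤ B) : variance X P ≤ B ^ 2 := by
  have := variance_le_sq_of_bounded (μ := P) (hB.mono fun ω h => abs_le.1 h) hX
  refine this.trans (le_of_eq ?_)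
  ring

/-- Bounded functions of `W₁` and `W₂` have small covariance if the maximal correlation is small. -/
lemma abs_integral_mul_sub_le {g₁ : α₁ → ℝ} {g₂ : α₂ → ℝ} (hW₁ : Measurable W₁)
    (hW₂ : Measurable W₂) (hg₁ : Measurable g₁) (hg₂ : Measurable g₂) {B₁ B₂ : ℝ}
    (hb₁ : ∀ᵐ ω ∂P, |g₁ (W₁ ω)| ≤ B₁) (hb₂ : ∀ᵐ ω ∂P, |g₂ (W₂ ω)| ≤ B₂) :
    |∫ ω, g₁ (W₁ ω) * g₂ (W₂ ω) ∂P - (∫ ω, g₁ (W₁ ω) ∂P) * ∫ ω, g₂ (W₂ ω) ∂P| ≤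
      maximalCorrelation P W₁ W₂ * (B₁ * B₂) := by
  have m1 : Measurable fun ω => g₁ (W₁ ω) := hg₁.comp hW₁
  have m2 : Measurable fun ω => g₂ (W₂ ω) := hg₂.comp hW₂
  have h1 : MemLp (fun ω => g₁ (W₁ ω)) 2 P := MemLp.of_bound m1.aestronglyMeasurable B₁ hb₁
  have h2 : MemLp (fun ω => g₂ (W₂ ω)) 2 P := MemLp.of_bound m2.aestronglyMeasurable B₂ hb₂
  have hcov := covariance_eq_sub h1 h2
  simp only [Pi.mul_apply] at hcov
  rw [← hcov]
  have hB1 : 0 ≤ B₁ := by obtain ⟨ω, hω⟩ := hb₁.exists; exact (abs_nonneg _).trans hω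
  have hB2 : 0 ≤ B₂ := by obtain ⟨ω, hω⟩ := hb₂.exists; exact (abs_nonneg _).trans hω
  have hθ := maximalCorrelation_nonneg P W₁ W₂
  have hv1 := variance_le_sq_of_ae_bound m1.aemeasurable hb₁
  have hv2 := variance_le_sq_of_ae_bound m2.aemeasurable hb₂
  have n1 := variance_nonneg (fun ω => g₁ (W₁ ω)) P
  have n2 := variance_nonneg (fun ω => g₂ (W₂ ω)) P
  by_cases hpos : 0 < variance (fun ω => g₁ (W₁ ω)) P ∧ 0 < variance (fun ω => g₂ (W₂ ω)) P
  · refine (abs_covariance_le_maximalCorrelation_of_pos hg₁ hg₂ h1 h2 hpos.1 hpos.2).trans ?_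
    refine mul_le_mul_of_nonneg_left (Real.sqrt_le_iff.2 ⟨by positivity, ?_⟩) hθ
    rw [mul_pow]
    exact mul_le_mul hv1 hv2 n2 (by positivity)
  -- Degenerate functions are excluded from the supremum, but their covariance vanishes by
  -- Cauchy–Schwarz.
  · have h0 : covariance (fun ω => g₁ (W₁ ω)) (fun ω => g₂ (W₂ ω)) P ^ 2 ≤ 0 := by
      refine (covariance_sq_le h1 h2).trans ?_
      rw [not_and_or, not_lt, not_lt] at hpos
      rcases hpos with h | h
      · rw [le_antisymm h n1, zero_mul]
      · rw [le_antisymm h n2, mul_zero]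
    rw [pow_eq_zero_iff two_ne_zero |>.1 (le_antisymm h0 (sq_nonneg _)), abs_zero]
    positivity

end MaximalCorrelation

/-! ### Decoupling the features in `S` from the others. -/

section Decoupling

variable {Q : Measure (Obs p)} [IsProbabilityMeasure Q] {S : Finset (Fin p)} {MY : ℝ}

lemma measurable_subFeatures (S : Finset (Fin p)) : Measurable (subFeatures S) := by
  unfold subFeatures; fun_prop

/-- The response may be replaced by a bounded function of the features in `S`. -/
lemma FullPredictivePower.exists_regression (hS : FullPredictivePower Q S)
    (hY : ∀ᵐ z ∂Q, |z.2| ≤ MY) :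
    ∃ f : (S → ℝ) → ℝ, Measurable f ∧ (∀ᵐ z ∂Q, |f (subFeatures S z)| ≤ MY) ∧
      ∀ G : (Fin p → ℝ) → ℝ, Measurable G → (∃ B, ∀ᵐ z ∂Q, |G z.1| ≤ B) →
        ∫ z, z.2 * G z.1 ∂Q = ∫ z, f (subFeatures S z) * G z.1 ∂Q := by
  have hMY : 0 ≤ MY := by obtain ⟨z, hz⟩ := hY.exists; exact (abs_nonneg _).trans hz
  have hint : Integrable (fun z : Obs p => z.2) Q := Integrable.of_bound (by fun_prop) MY hY
  have hle : MeasurableSpace.comap (fun z : Obs p => z.1) inferInstance ≤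
      (inferInstance : MeasurableSpace (Obs p)) := measurable_fst.comap_le
  obtain ⟨f, hf, hfe⟩ := (stronglyMeasurable_condExp (μ := Q) (f := fun z : Obs p => z.2)
    (m := MeasurableSpace.comap (subFeatures S) inferInstance)).measurable.exists_eq_measurable_comp
  have hbd : ∀ᵐ z ∂Q, |f (subFeatures S z)| ≤ MY := by
    have := ae_bdd_abs_condExp_of_ae_bdd_abs (μ := Q)
      (m := MeasurableSpace.comap (subFeatures S) inferInstance) hY
    rw [hfe] at this
    exact this
  refine ⟨f, hf, hbd, fun G hG ⟨B, hB⟩ => ?_⟩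
  have hGm : StronglyMeasurable[MeasurableSpace.comap (fun z : Obs p => z.1) inferInstance]
      (fun z : Obs p => G z.1) :=
    (hG.comp (comap_measurable (fun z : Obs p => z.1))).stronglyMeasurable
  have hpull := condExp_stronglyMeasurable_mul_of_bound hle hGm hint B hB
  have h1 : ∫ z, z.2 * G z.1 ∂Q = ∫ z, ((fun z : Obs p => G z.1) * fun z : Obs p => z.2) z ∂Q := by
    simp only [Pi.mul_apply, mul_comm]
  rw [h1, ← integral_condExp hle]
  refine integral_congr_ae ?_
  filter_upwards [hpull, hS] with z hz1 hz2
  rw [hz1, Pi.mul_apply, hz2, hfe, mul_comm, Function.comp_apply]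

/-- Decoupling of bounded functions of the features in `S` and outside `S`. -/
lemma abs_integral_response_mul_sub_le (hS : FullPredictivePower Q S)
    (hY : ∀ᵐ z ∂Q, |z.2| ≤ MY) {g₁ : (S → ℝ) → ℝ} {g₂ : ((Sᶜ : Finset (Fin p)) → ℝ) → ℝ}
    (hg₁ : Measurable g₁) (hg₂ : Measurable g₂) {B₁ B₂ : ℝ}
    (hb₁ : ∀ᵐ z ∂Q, |g₁ (subFeatures S z)| ≤ B₁)
    (hb₂ : ∀ᵐ z ∂Q, |g₂ (subFeatures Sᶜ z)| ≤ B₂) :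
    |∫ z, z.2 * (g₁ (subFeatures S z) * g₂ (subFeatures Sᶜ z)) ∂Q -
      (∫ z, z.2 * g₁ (subFeatures S z) ∂Q) * ∫ z, g₂ (subFeatures Sᶜ z) ∂Q| ≤
      maximalCorrelation Q (subFeatures S) (subFeatures Sᶜ) * (MY * B₁ * B₂) := by
  obtain ⟨f, hf, hfb, hfG⟩ := hS.exists_regression hY
  have hMY : 0 ≤ MY := by obtain ⟨z, hz⟩ := hY.exists; exact (abs_nonneg _).trans hz
  have hB1 : 0 ≤ B₁ := by obtain ⟨ω, hω⟩ := hb₁.exists; exact (abs_nonneg _).trans hω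
  have e1 := hfG (fun x => g₁ (fun i => x i) * g₂ (fun i => x i))
    ((hg₁.comp (by fun_prop)).mul (hg₂.comp (by fun_prop))) ⟨B₁ * B₂, by
      filter_upwards [hb₁, hb₂] with z h1 h2
      rw [abs_mul]
      exact mul_le_mul h1 h2 (abs_nonneg _) hB1⟩
  have e2 := hfG (fun x => g₁ (fun i => x i)) (hg₁.comp (by fun_prop)) ⟨B₁, hb₁⟩
  -- The regression function `f` depends on `X_S` only, so it is absorbed into the first factor.
  have hm := abs_integral_mul_sub_le (P := Q) (W₁ := subFeatures S) (W₂ := subFeatures Sᶜ)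
    (g₁ := fun s => f s * g₁ s) (measurable_subFeatures S) (measurable_subFeatures Sᶜ)
    (hf.mul hg₁) hg₂ (B₁ := MY * B₁) (B₂ := B₂) (by
      filter_upwards [hfb, hb₁] with z h1 h2
      rw [abs_mul]
      exact mul_le_mul h1 h2 (abs_nonneg _) hMY) hb₂
  simp only [mul_assoc] at hm e1 e2 ⊢
  change |∫ z : Obs p, z.2 * ((fun x : Fin p → ℝ => g₁ (fun i => x i) * g₂ (fun i => x i)) z.1) ∂Q -
    (∫ z : Obs p, z.2 * (fun x : Fin p → ℝ => g₁ (fun i => x i)) z.1 ∂Q) * _| ≤ _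
  rw [e1, e2]
  exact hm

/-- Decoupling for two independent copies. -/
lemma abs_integral_prod_sub_le (hS : FullPredictivePower Q S)
    (hY : ∀ᵐ z ∂Q, |z.2| ≤ MY) {G₁ : (S → ℝ) × (S → ℝ) → ℝ}
    {G₂ : ((Sᶜ : Finset (Fin p)) → ℝ) × ((Sᶜ : Finset (Fin p)) → ℝ) → ℝ}
    (hG₁ : Measurable G₁) (hG₂ : Measurable G₂) {B₁ B₂ : ℝ}
    (hb₁ : ∀ᵐ w ∂(Q.prod Q), |G₁ (subFeatures S w.1, subFeatures S w.2)| ≤ B₁)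
    (hb₂ : ∀ᵐ w ∂(Q.prod Q), |G₂ (subFeatures Sᶜ w.1, subFeatures Sᶜ w.2)| ≤ B₂) :
    |∫ w, w.1.2 * w.2.2 * (G₁ (subFeatures S w.1, subFeatures S w.2) *
        G₂ (subFeatures Sᶜ w.1, subFeatures Sᶜ w.2)) ∂(Q.prod Q) -
      (∫ w, w.1.2 * w.2.2 * G₁ (subFeatures S w.1, subFeatures S w.2) ∂(Q.prod Q)) *
        ∫ w, G₂ (subFeatures Sᶜ w.1, subFeatures Sᶜ w.2) ∂(Q.prod Q)| ≤
      2 * (maximalCorrelation Q (subFeatures S) (subFeatures Sᶜ) * (MY ^ 2 * B₁ * B₂)) := by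
  set θ := maximalCorrelation Q (subFeatures S) (subFeatures Sᶜ) with hθ
  have hMY : 0 ≤ MY := by obtain ⟨z, hz⟩ := hY.exists; exact (abs_nonneg _).trans hz
  have hB1 : 0 ≤ B₁ := by obtain ⟨ω, hω⟩ := hb₁.exists; exact (abs_nonneg _).trans hω
  have hB2 : 0 ≤ B₂ := by obtain ⟨ω, hω⟩ := hb₂.exists; exact (abs_nonneg _).trans hω
  have mS := measurable_subFeatures S
  have mSc := measurable_subFeatures Sᶜ
  have a1 := (Measure.quasiMeasurePreserving_fst (μ := Q) (ν := Q)).ae hY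
  have a2 := (Measure.quasiMeasurePreserving_snd (μ := Q) (ν := Q)).ae hY
  -- Decouple the second copy with the first one frozen, then the first copy with these partial
  -- integrals as the functions. The two errors add up to the factor `2`.
  let k₁ : (S → ℝ) → ℝ := fun s => ∫ z', z'.2 * G₁ (s, subFeatures S z') ∂Q
  let k₂ : ((Sᶜ : Finset (Fin p)) → ℝ) → ℝ := fun s => ∫ z', G₂ (s, subFeatures Sᶜ z') ∂Q
  have hk₁ : Measurable k₁ :=
    (StronglyMeasurable.integral_prod_right' (f := fun x : (S → ℝ) × Obs p =>
      x.2.2 * G₁ (x.1, subFeatures S x.2)) (by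
        refine Measurable.stronglyMeasurable ?_
        exact Measurable.mul (by fun_prop) (hG₁.comp (by fun_prop)))).measurable
  have hk₂ : Measurable k₂ :=
    (StronglyMeasurable.integral_prod_right' (f := fun x : ((Sᶜ : Finset (Fin p)) → ℝ) × Obs p =>
      G₂ (x.1, subFeatures Sᶜ x.2)) (by
        refine Measurable.stronglyMeasurable ?_
        exact hG₂.comp (by fun_prop))).measurable
  have m1 : Measurable fun w : Obs p × Obs p => G₁ (subFeatures S w.1, subFeatures S w.2) :=
    hG₁.comp (by fun_prop)
  have m2 : Measurable fun w : Obs p × Obs p => G₂ (subFeatures Sᶜ w.1, subFeatures Sᶜ w.2) :=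
    hG₂.comp (by fun_prop)
  have i2 : Integrable (fun w : Obs p × Obs p => G₂ (subFeatures Sᶜ w.1, subFeatures Sᶜ w.2))
      (Q.prod Q) := Integrable.of_bound m2.aestronglyMeasurable B₂ hb₂
  have i1 : Integrable (fun w : Obs p × Obs p => w.1.2 * w.2.2 *
      G₁ (subFeatures S w.1, subFeatures S w.2)) (Q.prod Q) := by
    refine Integrable.of_bound (by fun_prop) (MY * MY * B₁) ?_
    filter_upwards [a1, a2, hb₁] with w h1 h2 h3
    rw [norm_mul, norm_mul]
    exact mul_le_mul (mul_le_mul h1 h2 (norm_nonneg _) hMY) h3 (norm_nonneg _) (by positivity)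
  have i3 : Integrable (fun w : Obs p × Obs p => w.1.2 * w.2.2 *
      (G₁ (subFeatures S w.1, subFeatures S w.2) * G₂ (subFeatures Sᶜ w.1, subFeatures Sᶜ w.2)))
      (Q.prod Q) := by
    refine Integrable.of_bound (by fun_prop) (MY * MY * (B₁ * B₂)) ?_
    filter_upwards [a1, a2, hb₁, hb₂] with w h1 h2 h3 h4
    rw [norm_mul, norm_mul, norm_mul]
    exact mul_le_mul (mul_le_mul h1 h2 (norm_nonneg _) hMY)
      (mul_le_mul h3 h4 (norm_nonneg _) hB1) (by positivity) (by positivity)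
  have b1 := Measure.ae_ae_of_ae_prod hb₁
  have b2 := Measure.ae_ae_of_ae_prod hb₂
  have bk₁ : ∀ᵐ z ∂Q, |k₁ (subFeatures S z)| ≤ MY * B₁ := by
    filter_upwards [b1] with z hz
    have := norm_integral_le_of_norm_le_const (μ := Q) (C := MY * B₁)
      (f := fun z' => z'.2 * G₁ (subFeatures S z, subFeatures S z')) (by
        filter_upwards [hz, hY] with z' h1 h2
        rw [norm_mul]
        exact mul_le_mul h2 h1 (norm_nonneg _) hMY)
    simpa using this
  have bk₂ : ∀ᵐ z ∂Q, |k₂ (subFeatures Sᶜ z)| ≤ B₂ := by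
    filter_upwards [b2] with z hz
    have := norm_integral_le_of_norm_le_const (μ := Q) (C := B₂)
      (f := fun z' => G₂ (subFeatures Sᶜ z, subFeatures Sᶜ z')) hz
    simpa using this
  have step2 := abs_integral_response_mul_sub_le hS hY hk₁ hk₂ bk₁ bk₂
  have hinner : ∀ᵐ z ∂Q, |∫ z', z.2 * z'.2 * (G₁ (subFeatures S z, subFeatures S z') *
      G₂ (subFeatures Sᶜ z, subFeatures Sᶜ z')) ∂Q -
      z.2 * (k₁ (subFeatures S z) * k₂ (subFeatures Sᶜ z))| ≤ MY * (θ * (MY * B₁ * B₂)) := by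
    filter_upwards [b1, b2, hY] with z h1 h2 h3
    have := abs_integral_response_mul_sub_le hS hY
      (g₁ := fun s => G₁ (subFeatures S z, s)) (g₂ := fun s => G₂ (subFeatures Sᶜ z, s))
      (hG₁.comp (by fun_prop)) (hG₂.comp (by fun_prop)) h1 h2
    simp only [mul_assoc]
    rw [integral_const_mul, ← mul_sub, abs_mul]
    simp only [mul_assoc] at this
    exact mul_le_mul h3 this (abs_nonneg _) hMY
  have e1 : ∫ w, w.1.2 * w.2.2 * G₁ (subFeatures S w.1, subFeatures S w.2) ∂(Q.prod Q) =
      ∫ z, z.2 * k₁ (subFeatures S z) ∂Q := by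
    rw [integral_prod _ i1]
    simp only [mul_assoc, integral_const_mul, k₁]
  have e2 : ∫ w, G₂ (subFeatures Sᶜ w.1, subFeatures Sᶜ w.2) ∂(Q.prod Q) =
      ∫ z, k₂ (subFeatures Sᶜ z) ∂Q := integral_prod _ i2
  have ik : Integrable (fun z => z.2 * (k₁ (subFeatures S z) * k₂ (subFeatures Sᶜ z))) Q := by
    refine Integrable.of_bound (by fun_prop) (MY * (MY * B₁ * B₂)) ?_
    filter_upwards [hY, bk₁, bk₂] with z h1 h2 h3
    rw [norm_mul, norm_mul]
    exact mul_le_mul h1 (mul_le_mul h2 h3 (norm_nonneg _) (by positivity)) (by positivity) hMY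
  have step1 := norm_integral_le_of_norm_le_const (C := MY * (θ * (MY * B₁ * B₂)))
    (f := fun z => (∫ z', z.2 * z'.2 * (G₁ (subFeatures S z, subFeatures S z') *
      G₂ (subFeatures Sᶜ z, subFeatures Sᶜ z')) ∂Q) -
      z.2 * (k₁ (subFeatures S z) * k₂ (subFeatures Sᶜ z))) hinner
  rw [integral_sub i3.integral_prod_left ik, ← integral_prod _ i3, Real.norm_eq_abs,
    probReal_univ, mul_one] at step1
  rw [e1, e2]
  refine (abs_sub_le _ (∫ z, z.2 * (k₁ (subFeatures S z) * k₂ (subFeatures Sᶜ z)) ∂Q) _).trans ?_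
  refine (add_le_add step1 step2).trans (le_of_eq ?_)
  rw [← hθ]
  ring

end Decoupling

/-! ### Population bounds for the value and the slopes. -/

section Population

variable {p q : ℕ} {Q : Measure (Obs p)} {MX MY v : ℝ}

lemma ae_prod_response (hY : ∀ᵐ z ∂Q, |z.2| ≤ MY) :
    ∀ᵐ w ∂(Q.prod Q), |w.1.2 * w.2.2| ≤ MY ^ 2 := by
  filter_upwards [(Measure.quasiMeasurePreserving_fst (μ := Q) (ν := Q)).ae hY,
    (Measure.quasiMeasurePreserving_snd (μ := Q) (ν := Q)).ae hY] with w h1 h2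
  rw [abs_mul, pow_two]
  exact mul_le_mul h1 h2 (abs_nonneg _) ((abs_nonneg _).trans h1)

lemma ae_prod_features (hX : ∀ᵐ z ∂Q, ∀ i, |z.1 i| ≤ MX) :
    ∀ᵐ w ∂(Q.prod Q), ∀ i, |w.1.1 i - w.2.1 i| ^ q ≤ (2 * MX) ^ q := by
  filter_upwards [(Measure.quasiMeasurePreserving_fst (μ := Q) (ν := Q)).ae hX,
    (Measure.quasiMeasurePreserving_snd (μ := Q) (ν := Q)).ae hX] with w h1 h2 i
  refine pow_le_pow_left₀ (abs_nonneg _) ((abs_sub _ _).trans ?_) q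
  linarith [h1 i, h2 i]

variable [IsProbabilityMeasure Q]

section Mixture

/-- Fubini's theorem for mixtures of exponential kernels. -/
lemma integral_mul_mixture {Ω : Type*} [MeasurableSpace Ω] {P : Measure Ω} [IsProbabilityMeasure P]
    {μ : Measure ℝ} [IsFiniteMeasure μ] {g D : Ω → ℝ} (hg : Measurable g) (hD : Measurable D)
    {C : ℝ} (hgC : ∀ᵐ w ∂P, |g w| ≤ C) (hD0 : ∀ w, 0 ≤ D w) {r : ℝ → ℝ} (hr : Measurable r)
    {b : ℝ} (hμ : ∀ᵐ t ∂μ, 0 ≤ t ∧ |r t| ≤ b) :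
    Integrable (fun t => r t * ∫ w, g w * Real.exp (-(t * D w)) ∂P) μ ∧
    ∫ w, g w * ∫ t, r t * Real.exp (-(t * D w)) ∂μ ∂P =
      ∫ t, r t * ∫ w, g w * Real.exp (-(t * D w)) ∂P ∂μ := by
  have hf : Integrable (fun x : Ω × ℝ => g x.1 * (r x.2 * Real.exp (-(x.2 * D x.1))))
      (P.prod μ) := by
    refine Integrable.of_bound (by fun_prop) (C * b) ?_
    have a1 := (Measure.quasiMeasurePreserving_fst (μ := P) (ν := μ)).ae hgC
    have a2 := (Measure.quasiMeasurePreserving_snd (μ := P) (ν := μ)).ae hμ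
    filter_upwards [a1, a2] with x h1 h2
    rw [norm_mul, norm_mul, Real.norm_eq_abs, Real.norm_eq_abs, Real.norm_eq_abs, Real.abs_exp]
    have h3 : Real.exp (-(x.2 * D x.1)) ≤ 1 :=
      Real.exp_le_one_iff.2 (neg_nonpos.2 (mul_nonneg h2.1 (hD0 _)))
    refine mul_le_mul h1 ?_ (by positivity) ((abs_nonneg _).trans h1)
    exact (mul_le_of_le_one_right (abs_nonneg _) h3).trans h2.2
  have e : ∀ t, ∫ w, g w * (r t * Real.exp (-(t * D w))) ∂P =
      r t * ∫ w, g w * Real.exp (-(t * D w)) ∂P := fun t => by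
    rw [← integral_const_mul]; congr; ext w; ring
  constructor
  · simpa only [e] using hf.integral_prod_right
  · have := integral_integral_swap (f := fun w t => g w * (r t * Real.exp (-(t * D w)))) hf
    simpa only [e, ← integral_const_mul] using this

variable {μ : Measure ℝ} {β : EuclideanSpace ℝ (Fin p)}

lemma weightedNormPow_nonneg (hβ : ∀ i, 0 ≤ β i) (x : Fin p → ℝ) : 0 ≤ weightedNormPow q β x :=
  Finset.sum_nonneg fun i _ => mul_nonneg (hβ i) (by positivity)

/-- The value of the objective at one scale of the mixture. -/
def scaleValue (q : ℕ) (Q : Measure (Obs p)) (β : EuclideanSpace ℝ (Fin p)) (t : ℝ) : ℝ :=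
  ∫ w, w.1.2 * w.2.2 *
    Real.exp (-(t * weightedNormPow q β fun i => w.1.1 i - w.2.1 i)) ∂(Q.prod Q)

/-- The partial derivative of the objective at one scale of the mixture. -/
def scaleSlope (q : ℕ) (Q : Measure (Obs p)) (l : Fin p) (β : EuclideanSpace ℝ (Fin p))
    (t : ℝ) : ℝ :=
  ∫ w, w.1.2 * w.2.2 * |w.1.1 l - w.2.1 l| ^ q *
    Real.exp (-(t * weightedNormPow q β fun i => w.1.1 i - w.2.1 i)) ∂(Q.prod Q)

lemma measurable_weightedNormPow_sub (q : ℕ) (β : EuclideanSpace ℝ (Fin p)) :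
    Measurable fun w : Obs p × Obs p => weightedNormPow q β fun i => w.1.1 i - w.2.1 i := by
  unfold weightedNormPow; fun_prop

lemma neg_objective_eq_integral (hY : ∀ᵐ z ∂Q, |z.2| ≤ MY) [IsFiniteMeasure μ]
    (hμ : ∀ᵐ t ∂μ, 0 ≤ t) (hβ : ∀ i, 0 ≤ β i) :
    Integrable (scaleValue q Q β) μ ∧ -objective q μ Q β = ∫ t, scaleValue q Q β t ∂μ := by
  have := integral_mul_mixture (P := Q.prod Q) (μ := μ) (g := fun w => w.1.2 * w.2.2)
    (r := fun _ => 1) (b := 1) (by fun_prop) (measurable_weightedNormPow_sub q β)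
    (ae_prod_response hY) (fun w => weightedNormPow_nonneg hβ _) measurable_const
    (hμ.mono fun t ht => ⟨ht, by simp⟩)
  simp only [one_mul] at this
  refine ⟨this.1, ?_⟩
  rw [objective, neg_neg]
  exact this.2

lemma objectiveSlope_eq_integral (hX : ∀ᵐ z ∂Q, ∀ i, |z.1 i| ≤ MX) (hY : ∀ᵐ z ∂Q, |z.2| ≤ MY)
    [IsFiniteMeasure μ] {b : ℝ} (hμ : ∀ᵐ t ∂μ, 0 ≤ t ∧ t ≤ b) (hβ : ∀ i, 0 ≤ β i) (l : Fin p) :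
    Integrable (fun t => t * scaleSlope q Q l β t) μ ∧
      objectiveSlope q μ Q l β = ∫ t, t * scaleSlope q Q l β t ∂μ := by
  have := integral_mul_mixture (P := Q.prod Q) (μ := μ)
    (g := fun w => w.1.2 * w.2.2 * |w.1.1 l - w.2.1 l| ^ q) (C := MY ^ 2 * (2 * MX) ^ q)
    (r := fun t => t) (b := b) (by fun_prop) (measurable_weightedNormPow_sub q β)
    (by
      filter_upwards [ae_prod_response hY, ae_prod_features (q := q) hX] with w h1 h2
      rw [abs_mul, abs_of_nonneg (a := |w.1.1 l - w.2.1 l| ^ q) (by positivity)]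
      exact mul_le_mul h1 (h2 l) (by positivity) (by positivity))
    (fun w => weightedNormPow_nonneg hβ _) measurable_id
    (hμ.mono fun t ht => ⟨ht.1, by rw [abs_of_nonneg ht.1]; exact ht.2⟩)
  refine ⟨this.1, ?_⟩
  rw [← show _ = ∫ t, t * scaleSlope q Q l β t ∂μ from this.2, objectiveSlope]
  congr; ext w
  simp only [slopeKernel, kernelSlope]
  ring

lemma exponent_eq_sum (t : ℝ) (x : Fin p → ℝ) :
    t * weightedNormPow q β x = ∑ i, (t * β i) * |x i| ^ q := by
  simp only [weightedNormPow, Finset.mul_sum, mul_assoc]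

lemma scaleValue_nonneg (hq : q = 1 ∨ q = 2) (hY : ∀ᵐ z ∂Q, |z.2| ≤ MY) (hβ : ∀ i, 0 ≤ β i)
    {t : ℝ} (ht : 0 ≤ t) : 0 ≤ scaleValue q Q β t := by
  simp only [scaleValue, exponent_eq_sum]
  exact integral_weighted_nonneg hq (b := fun i => t * β i) (fun i => mul_nonneg ht (hβ i)) hY

/-- The value is the integral of `rootMean ^ 2`. If it were zero, every Fourier coefficient of the
response would vanish and no feature would be predictive. Full support is needed for the root to
exist. -/
lemma scaleValue_pos (hq : q = 1 ∨ q = 2) (hY : ∀ᵐ z ∂Q, |z.2| ≤ MY) (hc : ∫ z, z.2 ∂Q = 0)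
    (hE : ¬ FullPredictivePower Q ∅) (hβ : ∀ i, 0 < β i) {t : ℝ} (ht : 0 < t) :
    0 < scaleValue q Q β t := by
  refine lt_of_le_of_ne (scaleValue_nonneg hq hY (fun i => (hβ i).le) ht.le) fun h0 => hE ?_
  obtain ⟨ψ, hψ⟩ := exists_convolutionRoot hq (b := fun i => t * β i) fun i => mul_pos ht (hβ i)
  obtain ⟨hint, heq⟩ := hψ.integral_prod_eq hY
  simp only [Pi.sub_apply] at heq
  simp only [scaleValue, exponent_eq_sum] at h0
  rw [← h0, eq_comm, integral_eq_zero_iff_of_nonneg (fun u => sq_nonneg _) hint] at heq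
  refine fullPredictivePower_empty_of_fourier hY hc (hψ.fourier_eq_zero hY ?_)
  filter_upwards [heq] with u hu
  simpa using hu

/-- The objective is negative at every point with full support. -/
lemma objective_neg_of_pos (hq : q = 1 ∨ q = 2) (hY : ∀ᵐ z ∂Q, |z.2| ≤ MY)
    (hc : ∫ z, z.2 ∂Q = 0) (hE : ¬ FullPredictivePower Q ∅) (hμ : KernelMeasure μ)
    (hβ : ∀ i, 0 < β i) : objective q μ Q β < 0 := by
  have := hμ.finite
  obtain ⟨a, b, ha, -, hae⟩ := hμ.exists_bounds
  obtain ⟨hint, heq⟩ := neg_objective_eq_integral (q := q) hY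
    (hae.mono fun t ht => ha.le.trans ht.1) fun i => (hβ i).le
  have hpos : ∀ᵐ t ∂μ, 0 < scaleValue q Q β t :=
    hae.mono fun t ht => scaleValue_pos hq hY hc hE hβ (ha.trans_le ht.1)
  have h0 : 0 ≤ ∫ t, scaleValue q Q β t ∂μ := integral_nonneg_of_ae (hpos.mono fun t ht => ht.le)
  have hne : ∫ t, scaleValue q Q β t ∂μ ≠ 0 := fun h => by
    rw [integral_eq_zero_iff_of_nonneg_ae (hpos.mono fun t ht => ht.le) hint] at h
    have : (ae μ).NeBot := ae_neBot.2 hμ.ne_zero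
    obtain ⟨t, h1, h2⟩ := (hpos.and h).exists
    exact h1.ne' h2
  have := lt_of_le_of_ne h0 hne.symm
  linarith

end Mixture

section GradientBound

variable {μ : Measure ℝ} {β : EuclideanSpace ℝ (Fin p)} {S : Finset (Fin p)}

lemma variance_le_integral_sq_sub (l : Fin p) (c : ℝ) :
    variance (fun z : Obs p => z.1 l) Q ≤ ∫ z, (c - z.1 l) ^ 2 ∂Q := by
  have h1 : AEStronglyMeasurable (fun z : Obs p => z.1 l) Q := by fun_prop
  rw [← variance_const_sub h1 c]
  exact variance_le_expectation_sq (by fun_prop)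

/-- The expected power of the distance of two copies of a feature is bounded below by the
variance. -/
lemma integral_abs_sub_pow_ge (hq : q = 1 ∨ q = 2) (hX : ∀ᵐ z ∂Q, ∀ i, |z.1 i| ≤ MX)
    (hMX : 0 ≤ MX) {l : Fin p} (hv : v ≤ variance (fun z : Obs p => z.1 l) Q) :
    v / (1 + (2 * MX) ^ q) ≤ ∫ w, |w.1.1 l - w.2.1 l| ^ q ∂(Q.prod Q) := by
  set R := (2 * MX) ^ q with hR
  have hR0 : 0 ≤ R := by positivity
  have hbd := ae_prod_features (q := q) hX
  have hint : Integrable (fun w : Obs p × Obs p => |w.1.1 l - w.2.1 l| ^ q) (Q.prod Q) := by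
    refine Integrable.of_bound (by fun_prop) R (hbd.mono fun w hw => ?_)
    rw [Real.norm_eq_abs, abs_of_nonneg (by positivity)]
    exact hw l
  -- The factor `1 + R` covers both exponents: for `q = 1` one uses `d² ≤ R |d|`, for `q = 2` only
  -- `R ≥ 0`.
  have hsq : ∀ᵐ w ∂(Q.prod Q), (w.1.1 l - w.2.1 l) ^ 2 ≤ (1 + R) * |w.1.1 l - w.2.1 l| ^ q := by
    filter_upwards [hbd] with w hw
    have h1 := hw l
    rcases hq with rfl | rfl
    · rw [← sq_abs]
      simp only [pow_one] at h1 hR ⊢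
      have := abs_nonneg (w.1.1 l - w.2.1 l)
      nlinarith
    · rw [sq_abs]
      nlinarith [sq_nonneg (w.1.1 l - w.2.1 l)]
  have hint2 : Integrable (fun w : Obs p × Obs p => (w.1.1 l - w.2.1 l) ^ 2) (Q.prod Q) := by
    refine (hint.const_mul (1 + R)).mono' (by fun_prop) (hsq.mono fun w hw => ?_)
    rwa [Real.norm_eq_abs, abs_of_nonneg (sq_nonneg _)]
  have h1 : v ≤ ∫ w, (w.1.1 l - w.2.1 l) ^ 2 ∂(Q.prod Q) := by
    rw [integral_prod _ hint2]
    have h2 : ∫ _z : Obs p, v ∂Q ≤ ∫ z, ∫ z', (z.1 l - z'.1 l) ^ 2 ∂Q ∂Q :=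
      integral_mono (integrable_const _) hint2.integral_prod_left fun z =>
        hv.trans (variance_le_integral_sq_sub l (z.1 l))
    simpa using h2
  have h2 := integral_mono_ae hint2 (hint.const_mul (1 + R)) hsq
  rw [integral_const_mul] at h2
  rw [div_le_iff₀ (by positivity), mul_comm]
  linarith

/-- The distance restricted to the features in `S`. -/
def restrictedExponent (q : ℕ) (β : EuclideanSpace ℝ (Fin p)) (S : Finset (Fin p)) (t : ℝ)
    (s : (S → ℝ) × (S → ℝ)) : ℝ :=
  ∑ i : S, (t * β i) * |s.1 i - s.2 i| ^ q

lemma restrictedExponent_subFeatures (t : ℝ) (w : Obs p × Obs p) :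
    restrictedExponent q β S t (subFeatures S w.1, subFeatures S w.2) =
      ∑ i ∈ S, (t * β i) * |w.1.1 i - w.2.1 i| ^ q :=
  Finset.sum_coe_sort S fun i => (t * β i) * |w.1.1 i - w.2.1 i| ^ q

lemma restrictedExponent_add_compl (t : ℝ) (w : Obs p × Obs p) :
    t * (weightedNormPow q β fun i => w.1.1 i - w.2.1 i) =
      restrictedExponent q β S t (subFeatures S w.1, subFeatures S w.2) +
      restrictedExponent q β Sᶜ t (subFeatures Sᶜ w.1, subFeatures Sᶜ w.2) := by
  rw [restrictedExponent_subFeatures, restrictedExponent_subFeatures, Finset.sum_add_sum_compl,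
    exponent_eq_sum]

lemma measurable_restrictedExponent (t : ℝ) : Measurable (restrictedExponent q β S t) := by
  unfold restrictedExponent; fun_prop

lemma restrictedExponent_nonneg {t : ℝ} (ht : 0 ≤ t) (hβ : ∀ i, 0 ≤ β i)
    (s : (S → ℝ) × (S → ℝ)) : 0 ≤ restrictedExponent q β S t s :=
  Finset.sum_nonneg fun i _ => mul_nonneg (mul_nonneg ht (hβ i)) (by positivity)

lemma exp_neg_restrictedExponent_le_one {t : ℝ} (ht : 0 ≤ t) (hβ : ∀ i, 0 ≤ β i)
    (s : (S → ℝ) × (S → ℝ)) : |Real.exp (-restrictedExponent q β S t s)| ≤ 1 := by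
  rw [Real.abs_exp]
  exact Real.exp_le_one_iff.2 (neg_nonpos.2 (restrictedExponent_nonneg ht hβ s))

/-- The lower bound for the mean kernel weight of a feature. -/
def weightBound (p q : ℕ) (M MX v b : ℝ) : ℝ :=
  Real.exp (-(b * (p * (M * (2 * MX) ^ q)))) * (v / (1 + (2 * MX) ^ q))

/-- On the box and for bounded features the exponent is at most `b * p * M * (2 * MX) ^ q`, so the
exponential is bounded below and the variance bound remains. -/
lemma weightBound_le (hq : q = 1 ∨ q = 2) {M : ℝ} (hX : ∀ᵐ z ∂Q, ∀ i, |z.1 i| ≤ MX)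
    (hMX : 0 ≤ MX) {l : Fin p} (hv : v ≤ variance (fun z : Obs p => z.1 l) Q)
    (hβ : β ∈ feasibleSet p M) {t b : ℝ} (ht : 0 ≤ t) (htb : t ≤ b) (T : Finset (Fin p)) :
    weightBound p q M MX v b ≤ ∫ w, |w.1.1 l - w.2.1 l| ^ q *
      Real.exp (-restrictedExponent q β T t (subFeatures T w.1, subFeatures T w.2))
        ∂(Q.prod Q) := by
  have hbd := ae_prod_features (q := q) hX
  have mT := measurable_subFeatures T
  have mE := measurable_restrictedExponent (q := q) (β := β) (S := T) t
  have hint : Integrable (fun w : Obs p × Obs p => |w.1.1 l - w.2.1 l| ^ q) (Q.prod Q) := by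
    refine Integrable.of_bound (by fun_prop) ((2 * MX) ^ q) (hbd.mono fun w hw => ?_)
    rw [Real.norm_eq_abs, abs_of_nonneg (by positivity)]
    exact hw l
  have hint2 : Integrable (fun w : Obs p × Obs p => |w.1.1 l - w.2.1 l| ^ q *
      Real.exp (-restrictedExponent q β T t (subFeatures T w.1, subFeatures T w.2)))
      (Q.prod Q) := by
    refine hint.mono (by fun_prop) (ae_of_all _ fun w => ?_)
    rw [norm_mul]
    exact mul_le_of_le_one_right (norm_nonneg _)
      (exp_neg_restrictedExponent_le_one ht (fun i => (hβ i).1) _)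
  have hle : ∀ᵐ w ∂(Q.prod Q), Real.exp (-(b * (p * (M * (2 * MX) ^ q)))) *
      |w.1.1 l - w.2.1 l| ^ q ≤ |w.1.1 l - w.2.1 l| ^ q *
      Real.exp (-restrictedExponent q β T t (subFeatures T w.1, subFeatures T w.2)) := by
    filter_upwards [hbd] with w hw
    rw [mul_comm]
    refine mul_le_mul_of_nonneg_left (Real.exp_le_exp.2 (neg_le_neg ?_)) (by positivity)
    have hM : 0 ≤ M := (hβ l).1.trans (hβ l).2
    rw [restrictedExponent_subFeatures]
    calc ∑ i ∈ T, t * β i * |w.1.1 i - w.2.1 i| ^ q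
        ≤ ∑ i, t * β i * |w.1.1 i - w.2.1 i| ^ q :=
          Finset.sum_le_univ_sum_of_nonneg fun i =>
            mul_nonneg (mul_nonneg ht (hβ i).1) (by positivity)
      _ ≤ ∑ _i : Fin p, b * (M * (2 * MX) ^ q) := by
          refine Finset.sum_le_sum fun i _ => ?_
          rw [mul_assoc]
          exact mul_le_mul htb (mul_le_mul (hβ i).2 (hw i) (by positivity) hM)
            (mul_nonneg (hβ i).1 (by positivity)) (ht.trans htb)
      _ = _ := by simp; ring
  have h1 := integral_mono_ae (hint.const_mul _) hint2 hle
  rw [integral_const_mul] at h1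
  refine le_trans ?_ h1
  exact mul_le_mul_of_nonneg_left (integral_abs_sub_pow_ge hq hX hMX hv) (Real.exp_pos _).le

/-- At each scale, the slope in the direction of a feature outside `S` dominates the value, up to
an error proportional to the maximal correlation. -/
lemma scaleSlope_ge (hq : q = 1 ∨ q = 2) {M : ℝ} (hX : ∀ᵐ z ∂Q, ∀ i, |z.1 i| ≤ MX)
    (hMX : 0 ≤ MX) (hY : ∀ᵐ z ∂Q, |z.2| ≤ MY) (hv0 : 0 ≤ v) {l : Fin p}
    (hv : v ≤ variance (fun z : Obs p => z.1 l) Q) (hS : FullPredictivePower Q S) (hl : l ∉ S)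
    (hβ : β ∈ feasibleSet p M) {t b : ℝ} (ht : 0 ≤ t) (htb : t ≤ b) :
    weightBound p q M MX v b * scaleValue q Q β t -
      maximalCorrelation Q (subFeatures S) (subFeatures Sᶜ) *
        (2 * MY ^ 2 * (weightBound p q M MX v b + (2 * MX) ^ q)) ≤ scaleSlope q Q l β t := by
  set θ := maximalCorrelation Q (subFeatures S) (subFeatures Sᶜ)
  set c₀ := weightBound p q M MX v b with hc₀
  have hc₀0 : 0 ≤ c₀ := by rw [hc₀, weightBound]; positivity
  have hβ0 := fun i => (hβ i).1
  let G₁ : (S → ℝ) × (S → ℝ) → ℝ := fun s => Real.exp (-restrictedExponent q β S t s)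
  let V : ((Sᶜ : Finset (Fin p)) → ℝ) × ((Sᶜ : Finset (Fin p)) → ℝ) → ℝ :=
    fun s => Real.exp (-restrictedExponent q β Sᶜ t s)
  let l' : (Sᶜ : Finset (Fin p)) := ⟨l, Finset.mem_compl.2 hl⟩
  -- Since `l ∉ S`, differentiating in direction `l` changes only the outer factor, from `V` to `W`.
  -- The same `A` therefore governs both value and slope.
  let W : ((Sᶜ : Finset (Fin p)) → ℝ) × ((Sᶜ : Finset (Fin p)) → ℝ) → ℝ :=
    fun s => |s.1 l' - s.2 l'| ^ q * V s
  have mG₁ : Measurable G₁ := (measurable_restrictedExponent t).neg.exp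
  have mV : Measurable V := (measurable_restrictedExponent t).neg.exp
  have mW : Measurable W := Measurable.mul (by fun_prop) mV
  have bG₁ : ∀ᵐ w ∂(Q.prod Q), |G₁ (subFeatures S w.1, subFeatures S w.2)| ≤ 1 :=
    ae_of_all _ fun w => exp_neg_restrictedExponent_le_one ht hβ0 _
  have bV : ∀ᵐ w ∂(Q.prod Q), |V (subFeatures Sᶜ w.1, subFeatures Sᶜ w.2)| ≤ 1 :=
    ae_of_all _ fun w => exp_neg_restrictedExponent_le_one ht hβ0 _
  have bW : ∀ᵐ w ∂(Q.prod Q), |W (subFeatures Sᶜ w.1, subFeatures Sᶜ w.2)| ≤ (2 * MX) ^ q := by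
    filter_upwards [ae_prod_features (q := q) hX] with w hw
    simp only [W, abs_mul, abs_pow, abs_abs]
    exact (mul_le_of_le_one_right (by positivity)
      (exp_neg_restrictedExponent_le_one ht hβ0 _)).trans (hw l)
  have d1 := abs_integral_prod_sub_le hS hY mG₁ mW bG₁ bW
  have d2 := abs_integral_prod_sub_le hS hY mG₁ mV bG₁ bV
  set A := ∫ w, w.1.2 * w.2.2 * G₁ (subFeatures S w.1, subFeatures S w.2) ∂(Q.prod Q) with hA
  have hA0 : 0 ≤ A := by
    have := integral_weighted_nonneg (Q := Q) hq (b := fun i => if i ∈ S then t * β i else 0)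
      (fun i => by split_ifs; exacts [mul_nonneg ht (hβ0 i), le_rfl]) hY
    refine this.trans (le_of_eq ?_)
    rw [hA]
    congr; ext w
    simp only [G₁, restrictedExponent_subFeatures, ite_mul, zero_mul, Finset.sum_ite_mem,
      Finset.univ_inter]
  have e1 : ∫ w, w.1.2 * w.2.2 * (G₁ (subFeatures S w.1, subFeatures S w.2) *
      W (subFeatures Sᶜ w.1, subFeatures Sᶜ w.2)) ∂(Q.prod Q) = scaleSlope q Q l β t := by
    rw [scaleSlope]
    congr; ext w
    rw [restrictedExponent_add_compl (S := S), neg_add, Real.exp_add]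
    simp only [G₁, W, V, subFeatures, l']
    ring
  have e2 : ∫ w, w.1.2 * w.2.2 * (G₁ (subFeatures S w.1, subFeatures S w.2) *
      V (subFeatures Sᶜ w.1, subFeatures Sᶜ w.2)) ∂(Q.prod Q) = scaleValue q Q β t := by
    rw [scaleValue]
    congr; ext w
    rw [restrictedExponent_add_compl (S := S), neg_add, Real.exp_add]
  rw [e1] at d1
  rw [e2] at d2
  have h3 : c₀ ≤ ∫ w, W (subFeatures Sᶜ w.1, subFeatures Sᶜ w.2) ∂(Q.prod Q) :=
    weightBound_le hq hX hMX hv hβ ht htb Sᶜ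
  have h4 : ∫ w, V (subFeatures Sᶜ w.1, subFeatures Sᶜ w.2) ∂(Q.prod Q) ≤ 1 := by
    have := norm_integral_le_of_norm_le_const (μ := Q.prod Q) (C := 1)
      (f := fun w => V (subFeatures Sᶜ w.1, subFeatures Sᶜ w.2)) bV
    rw [Real.norm_eq_abs, probReal_univ, mul_one] at this
    exact (le_abs_self _).trans this
  have h5 := mul_le_mul_of_nonneg_left h3 hA0
  have h6 := mul_le_mul_of_nonneg_left h4 hA0
  have h7 := (abs_le.1 d1).1
  have h8 := (abs_le.1 d2).2
  -- Eliminating `A` between this bound and `scaleSlope ≥ c₀ * A - error` compares slope with value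
  -- directly.
  have h9 : scaleValue q Q β t ≤ A + 2 * (θ * (MY ^ 2 * 1 * 1)) := by linarith
  have h10 := mul_le_mul_of_nonneg_left h9 hc₀0
  linarith

/-- The slope of the objective in the direction of a feature outside `S` dominates its value, up
to an error proportional to the maximal correlation. -/
lemma objectiveSlope_ge (hq : q = 1 ∨ q = 2) {M : ℝ} (hX : ∀ᵐ z ∂Q, ∀ i, |z.1 i| ≤ MX)
    (hMX : 0 ≤ MX) (hY : ∀ᵐ z ∂Q, |z.2| ≤ MY) (hv0 : 0 ≤ v) {l : Fin p}
    (hv : v ≤ variance (fun z : Obs p => z.1 l) Q) (hS : FullPredictivePower Q S) (hl : l ∉ S)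
    (hβ : β ∈ feasibleSet p M) [IsFiniteMeasure μ] {a b : ℝ} (ha : 0 ≤ a)
    (hμ : ∀ᵐ t ∂μ, t ∈ Icc a b) :
    a * weightBound p q M MX v b * -objective q μ Q β -
      maximalCorrelation Q (subFeatures S) (subFeatures Sᶜ) *
        (b * (2 * MY ^ 2 * (weightBound p q M MX v b + (2 * MX) ^ q)) * μ.real univ) ≤
      objectiveSlope q μ Q l β := by
  have hβ0 := fun i => (hβ i).1
  obtain ⟨i1, e1⟩ := neg_objective_eq_integral (q := q) hY
    (hμ.mono fun t ht => ha.trans ht.1) hβ0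
  obtain ⟨i2, e2⟩ := objectiveSlope_eq_integral (q := q) hX hY
    (hμ.mono fun t ht => ⟨ha.trans ht.1, ht.2⟩) hβ0 l
  have hθ := maximalCorrelation_nonneg Q (subFeatures S) (subFeatures Sᶜ)
  set θ := maximalCorrelation Q (subFeatures S) (subFeatures Sᶜ)
  set c₀ := weightBound p q M MX v b with hc₀
  have hc₀0 : 0 ≤ c₀ := by rw [hc₀, weightBound]; positivity
  have hle : ∀ᵐ t ∂μ, a * c₀ * scaleValue q Q β t -
      θ * (b * (2 * MY ^ 2 * (c₀ + (2 * MX) ^ q))) ≤ t * scaleSlope q Q l β t := by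
    filter_upwards [hμ] with t ht
    have ht0 : 0 ≤ t := ha.trans ht.1
    have h1 := mul_le_mul_of_nonneg_left
      (scaleSlope_ge hq hX hMX hY hv0 hv hS hl hβ ht0 ht.2) ht0
    -- Replacing `t` by its lower bound `a` is legitimate because the value at each scale is
    -- nonnegative; in the error term `t` is replaced by `b`.
    have h2 : a * (c₀ * scaleValue q Q β t) ≤ t * (c₀ * scaleValue q Q β t) :=
      mul_le_mul_of_nonneg_right ht.1 (mul_nonneg hc₀0 (scaleValue_nonneg hq hY hβ0 ht0))
    have h3 : t * (θ * (2 * MY ^ 2 * (c₀ + (2 * MX) ^ q))) ≤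
        b * (θ * (2 * MY ^ 2 * (c₀ + (2 * MX) ^ q))) :=
      mul_le_mul_of_nonneg_right ht.2 (by positivity)
    linarith
  have h1 := integral_mono_ae ((i1.const_mul _).sub (integrable_const _)) i2 hle
  rw [integral_sub' (i1.const_mul _) (integrable_const _), integral_const_mul, integral_const,
    ← e1, ← e2, smul_eq_mul] at h1
  linarith

end GradientBound

end Population

/-! ### Concentration of the objective and its slopes. -/

section Concentration

/-- The two copies are replaced one at a time at cost `ε` each, with symmetry of `φ` turning the
second replacement into the first. Uniformity in the frozen observation `x` reduces the double sum
to ordinary sample means. -/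
lemma abs_integral_empiricalMeasure_prod_sub_le {Q : Measure (Obs p)} [IsProbabilityMeasure Q]
    {n : ℕ} (hn : 0 < n) {z : Fin n → Obs p} {K : Set (Obs p)} (hz : ∀ j, z j ∈ K)
    (hQK : ∀ᵐ x ∂Q, x ∈ K) {φ : Obs p → Obs p → ℝ}
    (hφ : Continuous fun w : Obs p × Obs p => φ w.1 w.2) (hsymm : ∀ w w', φ w w' = φ w' w)
    (hint : Integrable (fun w : Obs p × Obs p => φ w.1 w.2) (Q.prod Q))
    (hint' : ∀ x ∈ K, Integrable (φ x) Q) {ε : ℝ}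
    (hε : ∀ x ∈ K, |(n : ℝ)⁻¹ * ∑ j, φ x (z j) - ∫ y, φ x y ∂Q| ≤ ε) :
    |∫ w, φ w.1 w.2 ∂((empiricalMeasure z).prod (empiricalMeasure z)) -
      ∫ w, φ w.1 w.2 ∂(Q.prod Q)| ≤ 2 * ε := by
  have hn' : (0 : ℝ) < n := by exact_mod_cast hn
  rw [integral_empiricalMeasure_prod z hn hφ, integral_prod _ hint]
  have h1 : |(n : ℝ)⁻¹ * ∑ i, (n : ℝ)⁻¹ * ∑ j, φ (z i) (z j) -
      (n : ℝ)⁻¹ * ∑ i, ∫ y, φ (z i) y ∂Q| ≤ ε := by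
    rw [← mul_sub, ← Finset.sum_sub_distrib, abs_mul, abs_of_pos (inv_pos.2 hn'),
      inv_mul_le_iff₀ hn']
    refine (Finset.abs_sum_le_sum_abs _ _).trans ?_
    exact (Finset.sum_le_sum fun j _ => hε _ (hz j)).trans (by simp)
  have h2 : (n : ℝ)⁻¹ * ∑ i, ∫ y, φ (z i) y ∂Q = ∫ y, (n : ℝ)⁻¹ * ∑ i, φ y (z i) ∂Q := by
    rw [integral_const_mul, integral_finsetSum _ fun i _ => by
      simpa only [hsymm _ (z i)] using hint' _ (hz i)]
    simp only [hsymm _ (z _)]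
  have h3 : |(∫ y, (n : ℝ)⁻¹ * ∑ i, φ y (z i) ∂Q) - ∫ y, ∫ y', φ y y' ∂Q ∂Q| ≤ ε := by
    rw [← integral_sub _ hint.integral_prod_left]
    · have := norm_integral_le_of_norm_le_const (μ := Q) (C := ε)
        (f := fun y => (n : ℝ)⁻¹ * ∑ i, φ y (z i) - ∫ y', φ y y' ∂Q) (hQK.mono hε)
      rwa [probReal_univ, mul_one] at this
    · refine (integrable_finsetSum _ fun i _ => ?_).const_mul _
      simpa only [hsymm _ (z i)] using hint' _ (hz i)
  rw [← h2] at h3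
  rw [abs_le] at h1 h3 ⊢
  constructor <;> linarith

/-- The compact set of bounded observations. -/
def boundedObs (p : ℕ) (MX MY : ℝ) : Set (Obs p) :=
  (Set.univ.pi fun _ => Icc (-MX) MX) ×ˢ Icc (-MY) MY

lemma mem_boundedObs {MX MY : ℝ} {z : Obs p} :
    z ∈ boundedObs p MX MY ↔ (∀ i, |z.1 i| ≤ MX) ∧ |z.2| ≤ MY := by
  simp only [boundedObs, mem_prod, mem_univ_pi, mem_Icc, abs_le]

lemma isCompact_boundedObs (p : ℕ) (MX MY : ℝ) : IsCompact (boundedObs p MX MY) :=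
  (isCompact_univ_pi fun _ => isCompact_Icc).prod isCompact_Icc

/-- The objective and its partial derivatives concentrate uniformly on the feasible set. -/
lemma exists_objective_concentration {Q : Measure (Obs p)} [IsProbabilityMeasure Q] {MX MY : ℝ}
    (hX : ∀ᵐ z ∂Q, ∀ i, |z.1 i| ≤ MX) (hY : ∀ᵐ z ∂Q, |z.2| ≤ MY) {μ : Measure ℝ}
    (hμ : KernelMeasure μ) (q : ℕ) (M : ℝ) {ε : ℝ} (hε : 0 < ε) :
    ∃ c : ℝ, 0 < c ∧ ∃ n₀ : ℕ, 0 < n₀ ∧ ∀ n : ℕ, n₀ ≤ n →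
      ∃ A : Set (Fin n → Obs p), MeasurableSet A ∧
      ENNReal.ofReal (1 - Real.exp (-(c * n))) ≤ Measure.pi (fun _ => Q) A ∧
      ∀ z ∈ A, ∀ β ∈ feasibleSet p M,
        |objective q μ (empiricalMeasure z) β - objective q μ Q β| ≤ ε ∧
        ∀ l, |objectiveSlope q μ (empiricalMeasure z) l β - objectiveSlope q μ Q l β| ≤ ε := by
  set K := boundedObs p MX MY
  have hK : IsCompact K := isCompact_boundedObs p MX MY
  have hQK : ∀ᵐ z ∂Q, z ∈ K := by
    filter_upwards [hX, hY] with z h1 h2 using mem_boundedObs.2 ⟨h1, h2⟩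
  -- `none` carries the value and `some l` the slopes, so one event serves them all. Below, the
  -- first observation joins `β` as a compact parameter.
  let g : Option (Fin p) → EuclideanSpace ℝ (Fin p) → Obs p → Obs p → ℝ := fun o =>
    o.elim (valueKernel q μ) (slopeKernel q μ)
  have hg : ∀ o, Continuous fun x : EuclideanSpace ℝ (Fin p) × Obs p × Obs p =>
      g o x.1 x.2.1 x.2.2 := by
    rintro (_ | l)
    · exact continuous_valueKernel hμ q
    · exact continuous_slopeKernel hμ q l
  have hsymm : ∀ o β w w', g o β w w' = g o β w' w := by
    rintro (_ | l) β w w'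
    · exact valueKernel_swap q β w w'
    · exact slopeKernel_swap q l β w w'
  obtain ⟨c, hc, n₀, hn₀, H⟩ := exists_uniform_concentration Q hK hK.isClosed.measurableSet hQK
    ((isCompact_feasibleSet p M).prod hK) (ι := Option (Fin p))
    (g := fun o θ z => g o θ.1 θ.2 z) (fun o => (hg o).comp (by fun_prop :
      Continuous fun x : (EuclideanSpace ℝ (Fin p) × Obs p) × Obs p => (x.1.1, x.1.2, x.2)))
    (ε := ε / 2) (by positivity)
  refine ⟨c, hc, n₀, hn₀, fun n hn => ?_⟩
  obtain ⟨A, hA, hAm, hAz⟩ := H n hn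
  refine ⟨A, hA, hAm, fun z hz β hβ => ?_⟩
  have hn' : 0 < n := lt_of_lt_of_le hn₀ hn
  have key : ∀ o, |∫ w, g o β w.1 w.2 ∂((empiricalMeasure z).prod (empiricalMeasure z)) -
      ∫ w, g o β w.1 w.2 ∂(Q.prod Q)| ≤ ε := fun o => by
    have hcont : Continuous fun w : Obs p × Obs p => g o β w.1 w.2 :=
      (hg o).comp (Continuous.prodMk_right β)
    obtain ⟨C, hC⟩ := (hK.prod hK).exists_bound_of_continuousOn hcont.continuousOn
    have hint : Integrable (fun w : Obs p × Obs p => g o β w.1 w.2) (Q.prod Q) := by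
      refine Integrable.of_bound hcont.aestronglyMeasurable C ?_
      filter_upwards [(Measure.quasiMeasurePreserving_fst (μ := Q) (ν := Q)).ae hQK,
        (Measure.quasiMeasurePreserving_snd (μ := Q) (ν := Q)).ae hQK] with w h1 h2
      exact hC w ⟨h1, h2⟩
    have := abs_integral_empiricalMeasure_prod_sub_le hn' (hAz z hz).1 hQK hcont (hsymm o β) hint
      (fun x hx => Integrable.of_bound
        (hcont.comp (Continuous.prodMk_right x)).aestronglyMeasurable C
        (hQK.mono fun y hy => hC (x, y) ⟨hx, hy⟩))
      (fun x hx => (hAz z hz).2 o (β, x) ⟨hβ, hx⟩)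
    linarith
  constructor
  · have := key none
    rw [objective_eq, objective_eq, neg_sub_neg, abs_sub_comm]
    exact this
  · exact fun l => key (some l)

end Concentration

/-! ### Support recovery and the choice of constants. -/

lemma RegularPopulation.mono {Q : Measure (Obs p)} {MX MY v MX' MY' : ℝ}
    (h : RegularPopulation Q MX MY v) (hX : MX ≤ MX') (hY : MY ≤ MY') :
    RegularPopulation Q MX' MY' v where
  prob := h.prob
  centered := h.centered
  bounded_features := h.bounded_features.mono fun _ hz i => (hz i).trans hX
  bounded_response := h.bounded_response.mono fun _ hz => hz.trans hY
  variance_ge := h.variance_ge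

/-- At `β = 0` the kernel is constant and the expectation factors through `(E Y) ^ 2`. -/
lemma objective_zero_eq (q : ℕ) (μ : Measure ℝ) {Q : Measure (Obs p)} [IsProbabilityMeasure Q]
    (hc : ∫ z, z.2 ∂Q = 0) : objective q μ Q 0 = 0 := by
  have h : ∀ x : Fin p → ℝ, weightedNormPow q 0 x = 0 := fun x => by simp [weightedNormPow]
  simp only [objective, h]
  rw [integral_mul_const, integral_prod_mul (fun z : Obs p => z.2) (fun z : Obs p => z.2), hc]
  simp

/-- If the objective and its slopes are uniformly well approximated, then the gradient flow
recovers a nonempty subset of `S`. -/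
lemma IsGradientFlow.support_recovery {F F' : EuclideanSpace ℝ (Fin p) → ℝ}
    {s : Fin p → EuclideanSpace ℝ (Fin p) → ℝ} {M γ ε : ℝ} {S : Finset (Fin p)}
    {β₀ : EuclideanSpace ℝ (Fin p)} (hM : 0 ≤ M) (hγ : 0 < γ)
    (hF' : ContDiff ℝ 1 F') (hclose : ∀ β ∈ feasibleSet p M, |F' β - F β| ≤ ε ∧
      ∀ l, |gradient F' β l - s l β| ≤ ε)
    (hβ₀ : β₀ ∈ feasibleSet p M) (hneg : F β₀ < 0) (hzero : F 0 = 0)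
    (hs : ∀ l ∉ S, ∀ β ∈ feasibleSet p M, γ * -F β - γ / 4 * |F β₀| ≤ s l β)
    (hε : ε ≤ |F β₀| / 8) (hεγ : ε ≤ γ * |F β₀| / 8)
    {β : ℝ → EuclideanSpace ℝ (Fin p)} (hflow : IsGradientFlow F' (feasibleSet p M) β₀ β)
    {t : ℝ} (ht : 0 ≤ t) (htM : M / (γ * |F β₀| / 4) < t) :
    (coordSupport (β t)).Nonempty ∧ coordSupport (β t) ⊆ (S : Set (Fin p)) := by
  have hB := isCompact_feasibleSet p M
  have habs : |F β₀| = -F β₀ := abs_of_neg hneg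
  have h0 := (abs_le.1 (hclose β₀ hβ₀).1).2
  constructor
  · by_contra hcon
    rw [not_nonempty_iff_eq_empty, eq_empty_iff_forall_notMem] at hcon
    have hz : β t = 0 := by
      ext i
      simpa [coordSupport] using hcon i
    have h1 := hflow.objective_le hB (convex_feasibleSet p M) hF' ht
    rw [hz] at h1
    have hmem : (0 : EuclideanSpace ℝ (Fin p)) ∈ feasibleSet p M := fun i => by simpa using hM
    have h2 := (abs_le.1 (hclose 0 hmem).1).1
    -- At `0` the empirical objective is at least `-ε`, whereas descent keeps it at most `F β₀ + ε ≤
    -- -(7/8) |F β₀|`.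
    linarith
  · intro l hl
    by_contra hlS
    refine hl (hflow.coord_eq_zero hF' l (c := γ * |F β₀| / 4) ?_ ?_ ht htM)
    · have : 0 < |F β₀| := by linarith
      positivity
    · intro x hx hxF
      have h1 := (abs_le.1 (hclose x hx).1).1
      have h2 := (abs_le.1 ((hclose x hx).2 l)).1
      have h3 := hs l hlS x hx
      -- Descent and two approximations cost `2ε ≤ |F β₀| / 4`. The slope is then at least `(3/4 -
      -- 1/4 - 1/8) γ |F β₀|`, above the rate `γ |F β₀| / 4`.
      have h4 : γ * (|F β₀| * (3 / 4)) ≤ γ * -F x :=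
        mul_le_mul_of_nonneg_left (by linarith) hγ.le
      have h5 : 0 ≤ γ * |F β₀| := by positivity
      linarith

end MetricLearning

end

theorem mainTheorem7 (p q : ℕ) (hq : q = 1 ∨ q = 2) (M MX MY v : ℝ) (hM : 0 < M) (hv : 0 < v)
    (μ : MeasureTheory.Measure ℝ) (hμ : MetricLearning.KernelMeasure μ) :
    ∃ κ : ℝ, 0 < κ ∧
      ∀ Q : MeasureTheory.Measure (MetricLearning.Obs p),
        MetricLearning.RegularPopulation Q MX MY v →
      ∀ S : Finset (Fin p), MetricLearning.FullPredictivePower Q S →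
        ¬ MetricLearning.FullPredictivePower Q ∅ →
      ∀ β₀ : EuclideanSpace ℝ (Fin p), β₀ ∈ MetricLearning.feasibleSet p M →
        MetricLearning.coordSupport β₀ = Set.univ →
      0 < κ * |MetricLearning.objective q μ Q β₀| ∧
      (MetricLearning.maximalCorrelation Q (MetricLearning.subFeatures S)
          (MetricLearning.subFeatures Sᶜ) ≤ κ * |MetricLearning.objective q μ Q β₀| →
        ∃ c τ : ℝ, 0 < c ∧ 0 < τ ∧ ∃ n₀ : ℕ, ∀ n : ℕ, n₀ ≤ n →
          ∃ A : Set (Fin n → MetricLearning.Obs p), MeasurableSet A ∧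
            ENNReal.ofReal (1 - Real.exp (-(c * n))) ≤ MeasureTheory.Measure.pi (fun _ => Q) A ∧
            ∀ z ∈ A, ∀ β : ℝ → EuclideanSpace ℝ (Fin p),
              MetricLearning.IsGradientFlow
                (MetricLearning.objective q μ (MetricLearning.empiricalMeasure z))
                (MetricLearning.feasibleSet p M) β₀ β →
              ∀ t, τ ≤ t → (MetricLearning.coordSupport (β t)).Nonempty ∧
                MetricLearning.coordSupport (β t) ⊆ (S : Set (Fin p))) := by
  open MetricLearning in
  have := hμ.finite
  obtain ⟨a, b, ha, hab, hae⟩ := hμ.exists_bounds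
  set w := weightBound p q M |MX| v b with hw
  have hw0 : 0 < w := by rw [hw, weightBound]; positivity
  set γ := a * w with hγ
  have hγ0 : 0 < γ := by positivity
  set C := b * (2 * |MY| ^ 2 * (w + (2 * |MX|) ^ q)) * μ.real Set.univ with hC
  have hb : 0 < b := ha.trans_le hab
  have hC0 : 0 ≤ C := by positivity
  -- With this `κ` the correlation error `κ * |F β₀| * C` is at most `γ / 4 * |F β₀|`; the `+ 1`
  -- allows `C = 0`. Absolute values of `MX` and `MY` keep the constants meaningful for any real
  -- bounds.
  refine ⟨γ / (4 * (C + 1)), by positivity, fun Q hQ S hS hE β₀ hβ₀ hsupp => ?_⟩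
  have hQ' := hQ.mono (le_abs_self MX) (le_abs_self MY)
  have := hQ.prob
  have hX := hQ'.bounded_features
  have hY := hQ'.bounded_response
  have hpos : ∀ i, 0 < β₀ i := fun i => by
    have h1 : i ∈ coordSupport β₀ := by rw [hsupp]; trivial
    exact lt_of_le_of_ne (hβ₀ i).1 (Ne.symm h1)
  have hneg : objective q μ Q β₀ < 0 := objective_neg_of_pos hq hY hQ.centered hE hμ hpos
  set F₀ := |objective q μ Q β₀| with hF₀
  have hF₀0 : 0 < F₀ := abs_pos.2 hneg.ne
  refine ⟨by positivity, fun hθ => ?_⟩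
  set ε := F₀ * γ / (8 * (1 + γ)) with hε
  have hε1 : ε ≤ F₀ / 8 := by
    rw [hε, div_le_div_iff₀ (by positivity) (by positivity)]
    nlinarith
  have hε2 : ε ≤ γ * F₀ / 8 := by
    rw [hε, div_le_div_iff₀ (by positivity) (by positivity)]
    nlinarith [mul_pos hF₀0 hγ0, mul_pos (mul_pos hF₀0 hγ0) hγ0]
  obtain ⟨c, hc, n₀, hn₀, H⟩ := exists_objective_concentration hX hY hμ q M (ε := ε) (by positivity)
  -- The `+ 1` turns `τ ≤ t` into the strict inequality required for extinction.
  refine ⟨c, M / (γ * F₀ / 4) + 1, hc, by positivity, n₀, fun n hn => ?_⟩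
  obtain ⟨A, hA, hAm, hAz⟩ := H n hn
  refine ⟨A, hA, hAm, fun z hz β hflow t ht => ?_⟩
  have hn' : 0 < n := lt_of_lt_of_le hn₀ hn
  have hτ : 0 < M / (γ * F₀ / 4) := by positivity
  refine hflow.support_recovery (F := objective q μ Q) (s := objectiveSlope q μ Q) (ε := ε)
    hM.le hγ0 (contDiff_objective_empiricalMeasure z hμ hn' q)
    (fun β hβ => ⟨(hAz z hz β hβ).1, fun l => ?_⟩) hβ₀ hneg (objective_zero_eq q μ hQ.centered)
    (fun l hl β hβ => ?_) hε1 hε2 (by linarith) (by linarith)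
  · rw [gradient_objective_empiricalMeasure z hμ hn' q β l]
    exact (hAz z hz β hβ).2 l
  · refine le_trans ?_ (objectiveSlope_ge hq hX (abs_nonneg MX) hY hv.le (hQ.variance_ge l) hS hl hβ
      ha.le hae)
    refine sub_le_sub_left ?_ _
    calc _ ≤ γ / (4 * (C + 1)) * F₀ * C := mul_le_mul_of_nonneg_right hθ hC0
      _ = γ / 4 * F₀ * (C / (C + 1)) := by field_simp
      _ ≤ γ / 4 * F₀ * 1 := by
          gcongr
          rw [div_le_one (by positivity)]
          linarith
      _ = γ / 4 * F₀ := mul_one _
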